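/- Let $a>0$ be real and $\mu\in\mathbb{C}$. Let $\eta_1,\eta_2:\mathbb{R}\to[-\infty,+\infty]$ be functions such that $\eta_2(\xi)-\eta_1(\xi)>a$ for every $\xi\in\mathbb{R}$ and such that the region $$R=\{\,x=\eta+i\xi\in\mathbb{C} : \xi\in\mathbb{R},\ \eta_1(\xi)<\eta<\eta_2(\xi)\,\}$$ is open (for instance, $\eta_1$ and $\eta_2$ continuous); thus $R$ is a simply connected domain whose width in the direction of the real axis exceeds $a$ at every height $\operatorname{Im}x=\xi$. Let $f$ be analytic in $R$ and satisfy $$[f(x)+f(x+a)]'+f(x)^2-f(x+a)^2=\mu$$ for all $x$ with $x\in R$ and $x+a\in R$. Then $f$ extends to a meromorphic function $F$ on the whole complex plane $\mathbb{C}$, with $F=f$ on $R$, and every singularity of $F$ is a simple pole. -/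

import Mathlib

/-- The region of all `x = η + iξ` lying between the curves `Re x = η₁ (Im x)` and
`Re x = η₂ (Im x)`. The values `-∞` and `+∞` are allowed for the boundary functions. -/
def domainBetween (η₁ η₂ : ℝ → EReal) : Set ℂ :=
  {x : ℂ | η₁ x.im < (x.re : EReal) ∧ (x.re : EReal) < η₂ x.im}

/-- The region between `η₁` and `η₂` is `a`-wide on `I`: for every `ξ ∈ I` its width
`η₂ ξ - η₁ ξ` in the direction of the real axis, at height `Im x = ξ`, exceeds `a`. -/
def IsWideOn (a : ℝ) (η₁ η₂ : ℝ → EReal) (I : Set ℝ) : Prop :=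
  ∀ ξ ∈ I, (a : EReal) < η₂ ξ - η₁ ξ

/-- `f` solves `[f(x) + f(x+a)]' + f(x)² - f(x+a)² = μ` in `R`: the equation holds at every `x`
such that both `x` and `x + a` lie in `R`. -/
def IsDDESolutionOn (a : ℝ) (μ : ℂ) (f : ℂ → ℂ) (R : Set ℂ) : Prop :=
  ∀ x : ℂ, x ∈ R → x + (a : ℂ) ∈ R →
    deriv (fun y : ℂ => f y + f (y + (a : ℂ))) x + f x ^ 2 - f (x + (a : ℂ)) ^ 2 = μ

open Filter Topology

/-! Once `f` is known near `x`, the equation is a Riccati equation `g' = g² - V` for `g(x) = f(x +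
a)`, with `V = f' + f² - μ`. Writing `g = -φ'/φ` linearises it to `φ'' = V φ`, so `g` continues
wherever `φ` is single-valued and meromorphic. At a pole of `f` this could fail through monodromy,
so an invariant is needed that excludes it and is inherited by `g`.

The invariant is `HasOddSimplePoleAt`: integer residue `r`, and regular part odd up to order `2|r|`.
It makes the potential `m(m+1)/w² + U` with `U` even up to order `2m` (`exists_even_potential`). The
exponents are then `-m` and `m+1`, and the parity of `U` removes the logarithm at the resonance
(`exists_schrodinger_solution`). Comparing the Riccati equation at `w` and `-w` gives the invariant
for `g` (`hasOddSimplePoleAt_zero_of_riccati`).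

Each local Riccati solution thus pushes the continuation past a vertical line, and a supremum
argument carries it arbitrarily far right on a thin strip (`exists_isContinuation`). The reflection
`x ↦ -x` gives the left side. Rectangles around all points are glued by the identity theorem, and
normal forms fix the values at isolated points. -/

/-! ### Power series and Frobenius solutions. -/

theorem hasFPowerSeriesOnBall_tsum_of_norm_le {c : ℕ → ℂ} {A B : ℝ} (hB : 0 < B)
    (hc : ∀ n, ‖c n‖ ≤ A * B ^ n) :
    HasFPowerSeriesOnBall (fun w : ℂ => ∑' n, c n * w ^ n)
      (FormalMultilinearSeries.ofScalars ℂ c) 0 (ENNReal.ofReal B⁻¹) := by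
  have hr : ENNReal.ofReal B⁻¹ ≤ (FormalMultilinearSeries.ofScalars ℂ c).radius := by
    refine FormalMultilinearSeries.le_radius_of_bound _ A (r := B⁻¹.toNNReal) fun n => ?_
    rw [Real.coe_toNNReal _ (inv_nonneg.2 hB.le)]
    have h1 : ‖FormalMultilinearSeries.ofScalars ℂ c n‖ = ‖c n‖ := by simp
    rw [h1, inv_pow, ← div_eq_mul_inv, div_le_iff₀ (pow_pos hB n)]
    exact hc n
  have hpos : 0 < ENNReal.ofReal B⁻¹ := ENNReal.ofReal_pos.2 (inv_pos.2 hB)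
  have h := ((FormalMultilinearSeries.ofScalars ℂ c).hasFPowerSeriesOnBall
    (hpos.trans_le hr)).mono hpos hr
  refine h.congr fun w _ => ?_
  simp only [FormalMultilinearSeries.sum]
  refine tsum_congr fun n => ?_
  simp [FormalMultilinearSeries.coeff_ofScalars, mul_comm]

theorem HasFPowerSeriesOnBall.hasSum_coeff {f : ℂ → ℂ} {p : FormalMultilinearSeries ℂ ℂ ℂ}
    {r : ENNReal} (h : HasFPowerSeriesOnBall f p 0 r) {w : ℂ} (hw : w ∈ Metric.eball (0 : ℂ) r) :
    HasSum (fun n => p.coeff n * w ^ n) (f w) := by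
  have := h.hasSum hw
  simpa [FormalMultilinearSeries.apply_eq_pow_smul_coeff, mul_comm] using this

theorem HasFPowerSeriesOnBall.exists_deriv {f : ℂ → ℂ} {p : FormalMultilinearSeries ℂ ℂ ℂ}
    {r : ENNReal} (h : HasFPowerSeriesOnBall f p 0 r) :
    ∃ q : FormalMultilinearSeries ℂ ℂ ℂ, HasFPowerSeriesOnBall (deriv f) q 0 r ∧
      ∀ n, q.coeff n = (n + 1) * p.coeff (n + 1) := by
  refine ⟨_, (ContinuousLinearMap.apply ℂ ℂ (1 : ℂ)).comp_hasFPowerSeriesOnBall h.fderiv,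
    fun n => ?_⟩
  have := p.derivSeries_coeff_one n
  rw [nsmul_eq_mul] at this
  push_cast at this
  exact this

/-- Coefficients of the Frobenius solutions of `w ψ'' - 2 m ψ' = w U ψ`, where `U = ∑ u n w ^ n`. -/
noncomputable def frobeniusCoeff (m : ℕ) (u : ℕ → ℂ) (A B : ℂ) : ℕ → ℂ
  | 0 => A
  -- The free index `2m + 1` is `1` when `m = 0`; otherwise the constant term `-2m c₁ = 0` of the
  -- equation forces zero.
  | 1 => if m = 0 then B else 0
  | n + 2 => if n + 1 = 2 * m then B else
      (∑ i : Fin (n + 1), u (n - i) * frobeniusCoeff m u A B i) / ((n + 2) * (n + 1 - 2 * m))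

/-- In a convolution of odd total degree one index is odd, so vanishing odd terms of `u` and of the
earlier coefficients propagate up to the resonance. -/
theorem frobeniusCoeff_odd {m : ℕ} {u : ℕ → ℂ} (hu : ∀ k < 2 * m, Odd k → u k = 0) (A B : ℂ) :
    ∀ n, Odd n → n < 2 * m → frobeniusCoeff m u A B n = 0 := by
  intro n
  induction n using Nat.strong_induction_on with
  | _ n ih =>
    intro hn hlt
    match n, ih, hn, hlt with
    | 0, _, hn, _ => simp at hn
    | 1, _, _, hlt =>
      have : m ≠ 0 := by omega
      simp [frobeniusCoeff, this]
    | n + 2, ih, hn, hlt =>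
      have h1 : n + 1 ≠ 2 * m := by omega
      rw [frobeniusCoeff, if_neg h1, Finset.sum_eq_zero, zero_div]
      intro i _
      rcases Nat.even_or_odd (i : ℕ) with hi | hi
      · have : Odd (n - i) := by
          have := i.2
          rw [Nat.odd_iff] at *; rw [Nat.even_iff] at hi; omega
        rw [hu _ (by omega) this, zero_mul]
      · rw [ih i (by have := i.2; omega) hi (by have := i.2; omega), mul_zero]

/-- The point is the resonant index `n + 1 = 2m`, where the left factor is zero: the right side
vanishes too by parity, so no logarithm is needed and the coefficient there is free. -/
theorem frobeniusCoeff_rec {m : ℕ} {u : ℕ → ℂ} (hu : ∀ k < 2 * m, Odd k → u k = 0) (A B : ℂ)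
    (n : ℕ) :
    ((n : ℂ) + 2) * (n + 1 - 2 * m) * frobeniusCoeff m u A B (n + 2) =
      ∑ x ∈ Finset.HasAntidiagonal.antidiagonal n, u x.1 * frobeniusCoeff m u A B x.2 := by
  have hs : ∑ x ∈ Finset.HasAntidiagonal.antidiagonal n, u x.1 * frobeniusCoeff m u A B x.2 =
      ∑ i : Fin (n + 1), u (n - i) * frobeniusCoeff m u A B i := by
    rw [← Finset.Nat.sum_antidiagonal_swap, Finset.Nat.sum_antidiagonal_eq_sum_range_succ_mk,
      Finset.sum_range]
    rfl
  by_cases h1 : n + 1 = 2 * m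
  · have h2 : ((n : ℂ) + 1 - 2 * m) = 0 := by
      have : ((n + 1 : ℕ) : ℂ) = ((2 * m : ℕ) : ℂ) := by rw [h1]
      push_cast at this
      rw [this, sub_self]
    rw [h2, mul_zero, zero_mul, hs, eq_comm]
    refine Finset.sum_eq_zero fun i _ => ?_
    have hi2 := i.2
    rcases Nat.even_or_odd (i : ℕ) with hi | hi
    · have : Odd (n - i) := by
        rw [Nat.odd_iff] at *; rw [Nat.even_iff] at hi; omega
      rw [hu _ (by omega) this, zero_mul]
    · rw [frobeniusCoeff_odd hu A B i hi (by omega), mul_zero]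
  · have h2 : ((n : ℂ) + 1 - 2 * m) ≠ 0 := by
      intro h
      apply h1
      have : ((n + 1 : ℕ) : ℂ) = ((2 * m : ℕ) : ℂ) := by push_cast; linear_combination h
      exact_mod_cast this
    have h3 : ((n : ℂ) + 2) ≠ 0 := by
      have : ((n + 2 : ℕ) : ℂ) ≠ 0 := Nat.cast_ne_zero.2 (by omega)
      exact_mod_cast this
    rw [hs, frobeniusCoeff, if_neg h1]
    field_simp

/-- The `n + 1` summands are absorbed by the factor `n + 2`, and `n + 1 - 2m`, a nonzero integer off
resonance, has norm at least one. -/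
theorem norm_frobeniusCoeff_le (m : ℕ) {u : ℕ → ℂ} {C D : ℝ} (hC : 0 ≤ C) (hD : 1 ≤ D)
    (hCD : C ≤ D ^ 2) (hu : ∀ k, ‖u k‖ ≤ C * D ^ k) (A B : ℂ) (n : ℕ) :
    ‖frobeniusCoeff m u A B n‖ ≤ max ‖A‖ ‖B‖ * D ^ n := by
  have hM : 0 ≤ max ‖A‖ ‖B‖ := (norm_nonneg A).trans (le_max_left _ _)
  have hD0 : 0 ≤ D := zero_le_one.trans hD
  induction n using Nat.strong_induction_on with
  | _ n ih =>
    have hB : ‖B‖ ≤ max ‖A‖ ‖B‖ * D ^ n :=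
      (le_max_right _ _).trans (le_mul_of_one_le_right hM (one_le_pow₀ hD))
    match n, ih, hB with
    | 0, _, _ => simp [frobeniusCoeff]
    | 1, _, hB =>
      rw [frobeniusCoeff]
      split_ifs
      · exact hB
      · rw [norm_zero]; positivity
    | n + 2, ih, hB =>
      rw [frobeniusCoeff]
      split_ifs with h1
      · exact hB
      · have h2 : 1 ≤ ‖((n : ℂ) + 1 - 2 * m)‖ := by
          have : ((n : ℂ) + 1 - 2 * m) = (((n : ℤ) + 1 - 2 * m : ℤ) : ℂ) := by push_cast; ring
          rw [this, Complex.norm_intCast]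
          have h6 : ((n : ℤ) + 1 - 2 * m) ≠ 0 := by omega
          exact_mod_cast Int.one_le_abs h6
        have h3 : ‖((n : ℂ) + 2)‖ = n + 2 := by
          have : ((n : ℂ) + 2) = ((n + 2 : ℕ) : ℂ) := by push_cast; ring
          rw [this, Complex.norm_natCast]; push_cast; ring
        rw [norm_div, norm_mul, h3, div_le_iff₀ (by positivity)]
        have h4 : ‖∑ i : Fin (n + 1), u (n - i) * frobeniusCoeff m u A B i‖ ≤
            (n + 1) * (C * (max ‖A‖ ‖B‖ * D ^ n)) := by
          refine (norm_sum_le_of_le (f := fun i : Fin (n + 1) =>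
            u (n - i) * frobeniusCoeff m u A B i)
            (n := fun _ => C * (max ‖A‖ ‖B‖ * D ^ n)) _ fun i _ => ?_).trans_eq ?_
          · rw [norm_mul]
            have hi := i.2
            calc _ ≤ (C * D ^ (n - (i : ℕ))) * (max ‖A‖ ‖B‖ * D ^ (i : ℕ)) :=
                  mul_le_mul (hu _) (ih i (by omega)) (norm_nonneg _) (by positivity)
              _ = C * (max ‖A‖ ‖B‖ * (D ^ (n - (i : ℕ)) * D ^ (i : ℕ))) := by ring
              _ = _ := by rw [← pow_add, Nat.sub_add_cancel (by omega)]
          · simp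
        have h5 : C * (max ‖A‖ ‖B‖ * D ^ n) ≤ max ‖A‖ ‖B‖ * D ^ (n + 2) := by
          calc _ ≤ D ^ 2 * (max ‖A‖ ‖B‖ * D ^ n) := by gcongr
            _ = _ := by ring
        calc _ ≤ _ := h4
          _ ≤ (n + 2) * (max ‖A‖ ‖B‖ * D ^ (n + 2)) := by gcongr; norm_num
          _ ≤ (n + 2) * (max ‖A‖ ‖B‖ * D ^ (n + 2)) * ‖((n : ℂ) + 1 - 2 * m)‖ :=
              le_mul_of_one_le_right (by positivity) h2
          _ = _ := by ring

/-- Frobenius theory at a regular singular point with exponents `0` and `2 m + 1` for which the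
parity of the coefficient excludes logarithms. -/
theorem exists_frobenius_solution {m : ℕ} {U : ℂ → ℂ} {q : FormalMultilinearSeries ℂ ℂ ℂ}
    (hU : HasFPowerSeriesAt U q 0) (hu : ∀ k < 2 * m, Odd k → q.coeff k = 0) :
    ∃ ρ > 0, ∀ A B : ℂ, ∃ (ψ : ℂ → ℂ) (p : FormalMultilinearSeries ℂ ℂ ℂ),
      HasFPowerSeriesOnBall ψ p 0 (ENNReal.ofReal ρ) ∧ p.coeff 0 = A ∧ p.coeff (2 * m + 1) = B ∧
      ∀ w ∈ Metric.ball (0 : ℂ) ρ,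
        w * deriv (deriv ψ) w - 2 * m * deriv ψ w = w * U w * ψ w := by
  obtain ⟨r, hr⟩ := hU
  obtain ⟨s, hs0, hsr⟩ := ENNReal.lt_iff_exists_nnreal_btwn.1 hr.r_pos
  have hs0' : (0 : ℝ) < s := by exact_mod_cast hs0
  obtain ⟨C, hC0, hC⟩ := q.norm_mul_pow_le_of_lt_radius (hsr.trans_le hr.r_le)
  -- `D` depends on `U` alone, so the radius `D⁻¹` serves all initial data `A`, `B`.
  set D : ℝ := max 1 (max C (s : ℝ)⁻¹) with hD
  have hD1 : 1 ≤ D := le_max_left _ _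
  have hDC : C ≤ D := (le_max_left _ _).trans (le_max_right _ _)
  have hDs : (s : ℝ)⁻¹ ≤ D := (le_max_right _ _).trans (le_max_right _ _)
  have hD0 : 0 < D := zero_lt_one.trans_le hD1
  have hCD : C ≤ D ^ 2 := hDC.trans (by nlinarith)
  have hqc : ∀ k, ‖q.coeff k‖ ≤ C * D ^ k := by
    intro k
    rw [← FormalMultilinearSeries.norm_apply_eq_norm_coef]
    have h1 := hC k
    have h2 : (s : ℝ)⁻¹ ^ k ≤ D ^ k := by gcongr
    calc ‖q k‖ = (‖q k‖ * s ^ k) * (s : ℝ)⁻¹ ^ k := by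
          rw [mul_assoc, ← mul_pow, mul_inv_cancel₀ hs0'.ne', one_pow, mul_one]
      _ ≤ C * D ^ k := by gcongr
  refine ⟨D⁻¹, inv_pos.2 hD0, fun A B => ?_⟩
  set c := frobeniusCoeff m q.coeff A B with hc
  have hp := hasFPowerSeriesOnBall_tsum_of_norm_le hD0
    (norm_frobeniusCoeff_le m hC0.le hD1 hCD hqc A B)
  rw [← hc] at hp
  refine ⟨_, _, hp, ?_, ?_, ?_⟩
  · simp [FormalMultilinearSeries.coeff_ofScalars, hc, frobeniusCoeff]
  · rw [FormalMultilinearSeries.coeff_ofScalars]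
    rcases m with _ | m
    · simp [hc, frobeniusCoeff]
    · have : 2 * (m + 1) + 1 = (2 * m + 1) + 2 := by ring
      rw [this, hc, frobeniusCoeff, if_pos (by ring)]
  · intro w hw
    have hw' : w ∈ Metric.eball (0 : ℂ) (ENNReal.ofReal D⁻¹) := by
      rwa [Metric.eball_ofReal]
    obtain ⟨p1, hp1, hp1c⟩ := hp.exists_deriv
    obtain ⟨p2, hp2, hp2c⟩ := hp1.exists_deriv
    have s1 := hp1.hasSum_coeff hw'
    have s2 := hp2.hasSum_coeff hw'
    have s0 := hp.hasSum_coeff hw'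
    simp only [hp2c, hp1c, FormalMultilinearSeries.coeff_ofScalars] at s1 s2 s0
    have hwr : w ∈ Metric.eball (0 : ℂ) r := by
      refine Metric.eball_subset_eball ?_ hw'
      refine le_trans ?_ hsr.le
      rw [← ENNReal.ofReal_coe_nnreal]
      exact ENNReal.ofReal_le_ofReal (inv_le_of_inv_le₀ hs0' hDs)
    have sU := hr.hasSum_coeff hwr
    have hnU : Summable fun n => ‖q.coeff n * w ^ n‖ := sU.summable.norm
    have hn0 : Summable fun n => ‖c n * w ^ n‖ := s0.summable.norm
    have hprod : HasSum (fun n => ∑ x ∈ Finset.HasAntidiagonal.antidiagonal n,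
        (q.coeff x.1 * w ^ x.1) * (c x.2 * w ^ x.2)) (U w * ∑' n, c n * w ^ n) := by
      have e := tsum_mul_tsum_eq_tsum_sum_antidiagonal_of_summable_norm hnU hn0
      rw [sU.tsum_eq] at e
      rw [e]
      exact (summable_norm_sum_mul_antidiagonal_of_summable_norm hnU hn0).of_norm.hasSum
    -- The series of `w ψ''` starts in degree one, so the constant term of `ψ'` is split off; `hm1`
    -- shows that `2m` times it is zero.
    have s1' := (hasSum_nat_add_iff' 1).2 s1
    simp only [Finset.range_one, Finset.sum_singleton] at s1'
    have s1'' := s1'.mul_left (2 * (m : ℂ))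
    have s2' := s2.mul_left w
    have key := (s2'.sub s1'').unique ((hprod.mul_left w).congr_fun ?_)
    · have hm1 : 2 * (m : ℂ) * c 1 = 0 := by
        rcases m with _ | m
        · simp
        · simp [hc, frobeniusCoeff]
      push_cast at key
      simp only [zero_add, one_mul, pow_zero, mul_one] at key
      linear_combination key - hm1
    · intro n
      have hrec := frobeniusCoeff_rec hu A B n
      have : ∑ x ∈ Finset.HasAntidiagonal.antidiagonal n, (q.coeff x.1 * w ^ x.1) * (c x.2 * w ^ x.2) =
          w ^ n * ∑ x ∈ Finset.HasAntidiagonal.antidiagonal n, q.coeff x.1 * c x.2 := by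
        rw [Finset.mul_sum]
        refine Finset.sum_congr rfl fun x hx => ?_
        rw [← Finset.HasAntidiagonal.mem_antidiagonal.1 hx, pow_add]; ring
      rw [this, ← hc] at *
      rw [← hrec]
      push_cast
      ring

/-! ### Orders of vanishing and parity under `w ↦ -w`. -/

theorem AnalyticAt.comp_neg_zero {h : ℂ → ℂ} (hh : AnalyticAt ℂ h 0) :
    AnalyticAt ℂ (fun w => h (-w)) 0 :=
  AnalyticAt.comp_of_eq (f := fun w : ℂ => -w) hh analyticAt_id.neg neg_zero

theorem tendsto_neg_zero_nhds : Tendsto (fun w : ℂ => -w) (𝓝 0) (𝓝 0) :=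
  continuous_neg.tendsto' 0 0 neg_zero

theorem tendsto_neg_zero_nhdsNE : Tendsto (fun w : ℂ => -w) (𝓝[≠] 0) (𝓝[≠] 0) :=
  tendsto_nhdsWithin_iff.2 ⟨tendsto_neg_zero_nhds.mono_left nhdsWithin_le_nhds,
    eventually_nhdsWithin_of_forall fun _ hw => neg_ne_zero.2 hw⟩

theorem eventuallyEq_nhds_of_nhdsNE {f g : ℂ → ℂ} {z : ℂ} (hf : AnalyticAt ℂ f z)
    (hg : AnalyticAt ℂ g z) (h : f =ᶠ[𝓝[≠] z] g) : f =ᶠ[𝓝 z] g :=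
  (hf.frequently_eq_iff_eventually_eq hg).1 h.frequently

/-- A solution of a linear first order equation vanishing at a point vanishes identically. -/
theorem AnalyticAt.eventually_eq_zero_of_deriv_eq_mul {y k : ℂ → ℂ} {z : ℂ}
    (hy : AnalyticAt ℂ y z) (hk : AnalyticAt ℂ k z) (h0 : y z = 0)
    (h : deriv y =ᶠ[𝓝 z] fun w => k w * y w) : ∀ᶠ w in 𝓝 z, y w = 0 := by
  rw [← analyticOrderAt_eq_top]
  -- Differentiation lowers a finite order by one, while the equation makes the order of `y'` at
  -- least that of `y`.
  have h1 := hy.analyticOrderAt_deriv_add_one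
  simp only [h0, sub_zero] at h1
  have h2 : analyticOrderAt (deriv y) z = analyticOrderAt k z + analyticOrderAt y z := by
    rw [analyticOrderAt_congr h]; exact analyticOrderAt_mul hk hy
  by_contra hne
  obtain ⟨n, hn⟩ := ENat.ne_top_iff_exists.1 hne
  rw [← hn] at h1 h2
  have h3 : (n : ℕ∞) ≤ analyticOrderAt (deriv y) z := h2 ▸ le_add_self
  have h4 : (n : ℕ∞) + 1 ≤ n := by
    calc (n : ℕ∞) + 1 ≤ _ := by gcongr
      _ = n := h1
  have h5 : n + 1 ≤ n := by exact_mod_cast h4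
  omega

theorem iteratedDeriv_sub_comp_neg {U : ℂ → ℂ} (hU : AnalyticAt ℂ U 0) (n : ℕ) :
    iteratedDeriv n (fun w => U w - U (-w)) 0 = (1 - (-1) ^ n) * iteratedDeriv n U 0 := by
  rw [iteratedDeriv_fun_sub hU.contDiffAt hU.comp_neg_zero.contDiffAt, iteratedDeriv_comp_neg,
    neg_zero, smul_eq_mul]
  ring

theorem iteratedDeriv_eq_zero_of_odd {U : ℂ → ℂ} (hU : AnalyticAt ℂ U 0) {N : ℕ}
    (h : (N : ℕ∞) ≤ analyticOrderAt (fun w => U w - U (-w)) 0) {k : ℕ} (hk : k < N) (hodd : Odd k) :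
    iteratedDeriv k U 0 = 0 := by
  have h1 := (natCast_le_analyticOrderAt_iff_iteratedDeriv_eq_zero
    (hU.sub hU.comp_neg_zero)).1 h k hk
  change iteratedDeriv k (fun w => U w - U (-w)) 0 = 0 at h1
  rw [iteratedDeriv_sub_comp_neg hU, hodd.neg_one_pow] at h1
  norm_num at h1
  exact h1

/-- Odd derivatives of an even function vanish at the origin, so its order cannot be odd. -/
theorem even_of_analyticOrderAt_add_comp_neg {h : ℂ → ℂ} (hh : AnalyticAt ℂ h 0) {n : ℕ}
    (hn : analyticOrderAt (fun w => h w + h (-w)) 0 = n) : Even n := by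
  have ha : AnalyticAt ℂ (fun w => h w + h (-w)) 0 := hh.add hh.comp_neg_zero
  by_contra hodd
  rw [Nat.not_even_iff_odd] at hodd
  have h1 := (natCast_le_analyticOrderAt_iff_iteratedDeriv_eq_zero ha).1 hn.ge
  have h2 : ((n + 1 : ℕ) : ℕ∞) ≤ analyticOrderAt (fun w => h w + h (-w)) 0 := by
    refine (natCast_le_analyticOrderAt_iff_iteratedDeriv_eq_zero ha).2 fun i hi => ?_
    rcases Nat.lt_succ_iff_lt_or_eq.1 hi with hi | rfl
    · exact h1 i hi
    · rw [iteratedDeriv_fun_add hh.contDiffAt hh.comp_neg_zero.contDiffAt, iteratedDeriv_comp_neg,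
        neg_zero, smul_eq_mul, hodd.neg_one_pow]
      ring
  rw [hn] at h2
  have : n + 1 ≤ n := by exact_mod_cast h2
  omega

theorem deriv_add_comp_neg {h : ℂ → ℂ} (hh : AnalyticAt ℂ h 0) :
    ∀ᶠ w in 𝓝 (0 : ℂ), deriv (fun w => h w + h (-w)) w = deriv h w - deriv h (-w) := by
  filter_upwards [hh.eventually_analyticAt,
    tendsto_neg_zero_nhds.eventually hh.eventually_analyticAt] with w h1 h2
  have h3 : HasDerivAt (fun w => h (-w)) (-deriv h (-w)) w := by
    have := HasDerivAt.comp w h2.differentiableAt.hasDerivAt (hasDerivAt_neg w)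
    rwa [mul_neg_one] at this
  exact (h1.differentiableAt.hasDerivAt.add h3).deriv.trans (by ring)

theorem exists_eq_pow_mul_deriv {e : ℂ → ℂ} (he : AnalyticAt ℂ e 0) {n : ℕ}
    (hn : ((n + 1 : ℕ) : ℕ∞) ≤ analyticOrderAt e 0) :
    ∃ q, AnalyticAt ℂ q 0 ∧ ∀ᶠ w in 𝓝 0, e w = w ^ (n + 1) * q w ∧
      deriv e w = (n + 1) * w ^ n * q w + w ^ (n + 1) * deriv q w := by
  obtain ⟨q, hq, heq⟩ := (natCast_le_analyticOrderAt he).1 hn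
  refine ⟨q, hq, ?_⟩
  simp only [sub_zero, smul_eq_mul] at heq
  filter_upwards [heq, heq.eventually_nhds, hq.eventually_analyticAt] with w h1 h2 h3
  refine ⟨h1, ?_⟩
  rw [EventuallyEq.deriv_eq (f := fun w => w ^ (n + 1) * q w) h2]
  have := (hasDerivAt_pow (n + 1) w).mul h3.differentiableAt.hasDerivAt
  simp only [Nat.add_sub_cancel] at this
  refine this.deriv.trans ?_
  push_cast
  ring

/-- The Laurent expansion of `f' + f ^ 2 - μ`, for `f = r / w + h w` with `h` odd up to
order `2 |r|`, is `m (m + 1) / w ^ 2 + U w` with `U` even up to order `2 m`. -/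
theorem exists_even_potential {r : ℤ} {h : ℂ → ℂ} (hh : AnalyticAt ℂ h 0)
    (hodd : ((2 * r.natAbs : ℕ) : ℕ∞) ≤ analyticOrderAt (fun w => h w + h (-w)) 0) (μ : ℂ) :
    ∃ (m : ℕ) (U : ℂ → ℂ), (m : ℂ) * (m + 1) = r ^ 2 - r ∧ AnalyticAt ℂ U 0 ∧
      ((2 * m : ℕ) : ℕ∞) ≤ analyticOrderAt (fun w => U w - U (-w)) 0 ∧
      ∀ w ≠ 0, U w = 2 * r * h w / w + deriv h w + h w ^ 2 - μ := by
  have he : AnalyticAt ℂ (fun w => h w + h (-w)) 0 := hh.add hh.comp_neg_zero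
  rcases eq_or_ne r 0 with rfl | hr
  · refine ⟨0, fun w => deriv h w + h w ^ 2 - μ, by simp, ?_, by simp, fun w _ => by simp⟩
    exact (hh.deriv.add (hh.pow 2)).sub analyticAt_const
  have hh0 : h 0 = 0 := by
    have h1 : analyticOrderAt (fun w => h w + h (-w)) 0 ≠ 0 := by
      intro h0
      rw [h0] at hodd
      have : 2 * r.natAbs ≤ 0 := by exact_mod_cast hodd
      omega
    have := apply_eq_zero_of_analyticOrderAt_ne_zero h1
    simp only [neg_zero] at this
    linear_combination this / 2
  have hds : AnalyticAt ℂ (dslope h 0) 0 := by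
    obtain ⟨p, hp⟩ := hh
    exact ⟨_, hp.has_fpower_series_dslope_fslope⟩
  set U : ℂ → ℂ := fun w => 2 * r * dslope h 0 w + deriv h w + h w ^ 2 - μ with hUdef
  have hU : AnalyticAt ℂ U 0 :=
    (((analyticAt_const.mul hds).add hh.deriv).add (hh.pow 2)).sub analyticAt_const
  have hUw : ∀ w ≠ 0, U w = 2 * r * h w / w + deriv h w + h w ^ 2 - μ := by
    intro w hw
    simp only [hUdef, dslope_of_ne _ hw, slope_def_field, hh0, sub_zero]
    ring
  obtain ⟨N, hN⟩ : ∃ N, 2 * r.natAbs = N + 1 + 1 := ⟨2 * r.natAbs - 2, by omega⟩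
  rw [hN] at hodd
  obtain ⟨q, hq, hqe⟩ := exists_eq_pow_mul_deriv he hodd
  -- With `e(w) = h(w) + h(-w) = w^(2|r|) q`, the difference is `2r e/w + e' + e (h(w) - h(-w))`.
  -- Its leading coefficient `2r + 2|r|` vanishes for `r < 0`, where `m = |r|`; for `r > 0`, `m = r
  -- - 1` and no cancellation is needed.
  have hdiff : ∀ᶠ w in 𝓝[≠] (0 : ℂ), U w - U (-w) =
      (2 * r + N + 2) * (w ^ (N + 1) * q w) +
      w ^ (N + 2) * (deriv q w + q w * (h w - h (-w))) := by
    filter_upwards [hqe.filter_mono nhdsWithin_le_nhds,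
      (deriv_add_comp_neg hh).filter_mono nhdsWithin_le_nhds, self_mem_nhdsWithin]
      with w h1 h2 hw
    have hw' : w ≠ 0 := hw
    rw [hUw w hw', hUw (-w) (neg_ne_zero.2 hw')]
    have e1 : h (-w) = w ^ (N + 1 + 1) * q w - h w := by linear_combination h1.1
    have e2 : deriv h (-w) = deriv h w - ((↑(N + 1) + 1) * w ^ (N + 1) * q w +
        w ^ (N + 1 + 1) * deriv q w) := by
      rw [← h1.2, h2]; ring
    rw [e1, e2]
    push_cast
    field_simp
    ring
  have hV : AnalyticAt ℂ (fun w => U w - U (-w)) 0 := hU.sub hU.comp_neg_zero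
  have hd : AnalyticAt ℂ (fun w => deriv q w + q w * (h w - h (-w))) 0 :=
    hq.deriv.add (hq.mul (hh.sub hh.comp_neg_zero))
  rcases lt_or_gt_of_ne hr with hneg | hpos
  · refine ⟨r.natAbs, U, ?_, hU, ?_, hUw⟩
    · have : ((r.natAbs : ℕ) : ℂ) = -r := by
        have : ((r.natAbs : ℕ) : ℤ) = -r := by omega
        have h1 := congrArg (Int.cast : ℤ → ℂ) this
        rwa [Int.cast_natCast, Int.cast_neg] at h1
      rw [this]; ring
    · rw [hN]
      refine (natCast_le_analyticOrderAt hV).2 ⟨_, hd, ?_⟩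
      refine eventuallyEq_nhds_of_nhdsNE hV
        (((analyticAt_id.sub analyticAt_const).pow _).smul hd) (hdiff.mono fun w hw => ?_)
      have : (2 * r + N + 2 : ℂ) = 0 := by
        have : 2 * r + N + 2 = 0 := by omega
        exact_mod_cast congrArg (Int.cast : ℤ → ℂ) this
      rw [this] at hw
      simpa using hw
  · refine ⟨r.natAbs - 1, U, ?_, hU, ?_, hUw⟩
    · have : ((r.natAbs - 1 : ℕ) : ℂ) = r - 1 := by
        have : ((r.natAbs - 1 : ℕ) : ℤ) = r - 1 := by omega
        exact_mod_cast congrArg (Int.cast : ℤ → ℂ) this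
      rw [this]; ring
    · have hm : 2 * (r.natAbs - 1) = N := by omega
      rw [hm]
      have hG : AnalyticAt ℂ (fun w => (2 * r + N + 2) * (w * q w) +
          w ^ 2 * (deriv q w + q w * (h w - h (-w)))) 0 :=
        (analyticAt_const.mul (analyticAt_id.mul hq)).add ((analyticAt_id.pow 2).mul hd)
      refine (natCast_le_analyticOrderAt hV).2 ⟨_, hG, ?_⟩
      refine eventuallyEq_nhds_of_nhdsNE hV
        (((analyticAt_id.sub analyticAt_const).pow _).smul hG) (hdiff.mono fun w hw => ?_)
      simp only [sub_zero, smul_eq_mul]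
      rw [hw]; ring

/-! ### Single-valued solutions of the Schrödinger equation. -/

theorem deriv_mul_zpow_neg {ψ : ℂ → ℂ} {w : ℂ} (hw : w ≠ 0) (hψ : AnalyticAt ℂ ψ w) (m : ℕ) :
    deriv (fun w => ψ w * w ^ (-(m : ℤ))) w =
      (deriv ψ w - m * ψ w / w) * w ^ (-(m : ℤ)) := by
  have h1 := hψ.differentiableAt.hasDerivAt.mul (hasDerivAt_zpow (-(m : ℤ)) w (Or.inl hw))
  refine h1.deriv.trans ?_
  rw [zpow_sub_one₀ hw]
  push_cast
  field_simp
  ring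

/-- The factor `w^(-m)` shifts the exponents `0`, `2m + 1` of the Frobenius equation to `-m`, `m +
1`. -/
theorem deriv_deriv_mul_zpow_neg {ψ : ℂ → ℂ} {w : ℂ} (hw : w ≠ 0) (hψ : AnalyticAt ℂ ψ w) (m : ℕ)
    {u : ℂ} (h : w * deriv (deriv ψ) w - 2 * m * deriv ψ w = w * u * ψ w) :
    deriv (deriv fun w => ψ w * w ^ (-(m : ℤ))) w =
      (m * (m + 1) / w ^ 2 + u) * (ψ w * w ^ (-(m : ℤ))) := by
  have h1 : deriv (fun w => ψ w * w ^ (-(m : ℤ))) =ᶠ[𝓝 w]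
      fun w => (deriv ψ w - m * ψ w / w) * w ^ (-(m : ℤ)) := by
    filter_upwards [hψ.eventually_analyticAt, isOpen_ne.mem_nhds hw] with x hx hx0
    exact deriv_mul_zpow_neg hx0 hx m
  rw [h1.deriv_eq]
  have hd := hψ.differentiableAt.hasDerivAt
  have hdd := hψ.deriv.differentiableAt.hasDerivAt
  have h2 := (hdd.sub ((hd.const_mul (m : ℂ)).div (hasDerivAt_id w) hw)).mul
    (hasDerivAt_zpow (-(m : ℤ)) w (Or.inl hw))
  refine h2.deriv.trans ?_
  rw [zpow_sub_one₀ hw]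
  have h3 : deriv (deriv ψ) w = u * ψ w + 2 * m * deriv ψ w / w := by
    field_simp
    linear_combination h
  rw [h3]
  simp only [Pi.sub_apply, Pi.div_apply, id]
  push_cast
  field_simp
  ring

/-- Near a singularity `m (m + 1) / w ^ 2 + U w`, with `U` even up to order `2 m`, all solutions of
the Schrödinger equation are single-valued and meromorphic. -/
theorem exists_schrodinger_solution {m : ℕ} {U : ℂ → ℂ} (hU : AnalyticAt ℂ U 0)
    (heven : ((2 * m : ℕ) : ℕ∞) ≤ analyticOrderAt (fun w => U w - U (-w)) 0) :
    ∃ ρ > 0, ∀ z ∈ Metric.ball (0 : ℂ) ρ, z ≠ 0 → ∀ c d : ℂ, ∃ φ : ℂ → ℂ,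
      MeromorphicAt φ 0 ∧ φ z = c ∧ deriv φ z = d ∧
      ∀ w ∈ Metric.ball (0 : ℂ) ρ, w ≠ 0 → AnalyticAt ℂ φ w ∧
        deriv (deriv φ) w = (m * (m + 1) / w ^ 2 + U w) * φ w := by
  have hcoeff : ∀ k < 2 * m, Odd k → (FormalMultilinearSeries.ofScalars ℂ
      (fun n ↦ iteratedDeriv n U 0 / n.factorial)).coeff k = 0 := by
    intro k hk hodd
    rw [FormalMultilinearSeries.coeff_ofScalars, iteratedDeriv_eq_zero_of_odd hU heven hk hodd,
      zero_div]
  obtain ⟨ρ, hρ, H⟩ := exists_frobenius_solution hU.hasFPowerSeriesAt hcoeff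
  obtain ⟨ψ₁, p₁, hψ₁, hp₁0, -, hode₁⟩ := H 1 0
  obtain ⟨ψ₂, p₂, hψ₂, hp₂0, hp₂1, hode₂⟩ := H 0 1
  have ha₁ : ∀ w ∈ Metric.ball (0 : ℂ) ρ, AnalyticAt ℂ ψ₁ w := fun w hw =>
    hψ₁.analyticAt_of_mem (by rwa [Metric.eball_ofReal])
  have ha₂ : ∀ w ∈ Metric.ball (0 : ℂ) ρ, AnalyticAt ℂ ψ₂ w := fun w hw =>
    hψ₂.analyticAt_of_mem (by rwa [Metric.eball_ofReal])
  have h0 : (0 : ℂ) ∈ Metric.ball (0 : ℂ) ρ := Metric.mem_ball_self hρ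
  have hψ₁0 : ψ₁ 0 = 1 := (hψ₁.coeff_zero _).symm.trans hp₁0
  have hψ₂0 : ψ₂ 0 = 0 := (hψ₂.coeff_zero _).symm.trans hp₂0
  have hW : AnalyticAt ℂ (fun w => ψ₁ w * deriv ψ₂ w - deriv ψ₁ w * ψ₂ w) 0 :=
    ((ha₁ 0 h0).mul (ha₂ 0 h0).deriv).sub ((ha₁ 0 h0).deriv.mul (ha₂ 0 h0))
  -- If the Wronskian vanished identically, `ψ₂' = (ψ₁'/ψ₁) ψ₂` with `ψ₂ 0 = 0` would give `ψ₂ = 0`,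
  -- against its coefficient `1` at index `2m + 1`.
  have hWne : ∀ᶠ w in 𝓝[≠] (0 : ℂ), ψ₁ w * deriv ψ₂ w - deriv ψ₁ w * ψ₂ w ≠ 0 := by
    refine hW.eventually_eq_zero_or_eventually_ne_zero.resolve_left fun hzero => ?_
    have hne : ∀ᶠ w in 𝓝 (0 : ℂ), ψ₁ w ≠ 0 :=
      (ha₁ 0 h0).continuousAt.eventually_ne (by rw [hψ₁0]; exact one_ne_zero)
    have hψ₂z : ∀ᶠ w in 𝓝 (0 : ℂ), ψ₂ w = 0 := by
      refine (ha₂ 0 h0).eventually_eq_zero_of_deriv_eq_mul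
        ((ha₁ 0 h0).deriv.div (ha₁ 0 h0) hne.self_of_nhds) hψ₂0 ?_
      filter_upwards [hzero, hne] with w hw hw1
      simp only [Pi.div_apply]
      field_simp
      linear_combination hw
    have hpz : p₂ = 0 := hψ₂.hasFPowerSeriesAt.locally_zero_iff.1 hψ₂z
    rw [hpz] at hp₂1
    simp [FormalMultilinearSeries.coeff] at hp₂1
  obtain ⟨δ, hδ, hWδ⟩ := Metric.mem_nhdsWithin_iff.1 hWne
  refine ⟨min ρ δ, lt_min hρ hδ, fun z hz hz0 c d => ?_⟩
  have hzρ : z ∈ Metric.ball (0 : ℂ) ρ := Metric.ball_subset_ball (min_le_left _ _) hz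
  have hWz : ψ₁ z * deriv ψ₂ z - deriv ψ₁ z * ψ₂ z ≠ 0 :=
    hWδ ⟨Metric.ball_subset_ball (min_le_right _ _) hz, hz0⟩
  set W := ψ₁ z * deriv ψ₂ z - deriv ψ₁ z * ψ₂ z with hWdef
  -- `c'`, `d'` are the data at `z` of `ψ = w^m φ`; `α`, `β` come from Cramer's rule.
  set c' := c * z ^ m with hc'
  set d' := d * z ^ m + m * c' / z with hd'
  set α := (c' * deriv ψ₂ z - d' * ψ₂ z) / W with hα
  set β := (ψ₁ z * d' - deriv ψ₁ z * c') / W with hβ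
  set ψ : ℂ → ℂ := fun w => α * ψ₁ w + β * ψ₂ w with hψdef
  have hψ : ∀ w ∈ Metric.ball (0 : ℂ) ρ, AnalyticAt ℂ ψ w := fun w hw =>
    (analyticAt_const.mul (ha₁ w hw)).add (analyticAt_const.mul (ha₂ w hw))
  have hψ' : ∀ w ∈ Metric.ball (0 : ℂ) ρ, deriv ψ w = α * deriv ψ₁ w + β * deriv ψ₂ w :=
    fun w hw => (((ha₁ w hw).differentiableAt.hasDerivAt.const_mul α).add
      ((ha₂ w hw).differentiableAt.hasDerivAt.const_mul β)).deriv
  have hψ'' : ∀ w ∈ Metric.ball (0 : ℂ) ρ,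
      deriv (deriv ψ) w = α * deriv (deriv ψ₁) w + β * deriv (deriv ψ₂) w := by
    intro w hw
    have : deriv ψ =ᶠ[𝓝 w] fun w => α * deriv ψ₁ w + β * deriv ψ₂ w :=
      eventually_of_mem (Metric.isOpen_ball.mem_nhds hw) hψ'
    rw [this.deriv_eq]
    exact (((ha₁ w hw).deriv.differentiableAt.hasDerivAt.const_mul α).add
      ((ha₂ w hw).deriv.differentiableAt.hasDerivAt.const_mul β)).deriv
  have hzm : z ^ m ≠ 0 := pow_ne_zero _ hz0
  have hψz : ψ z = c' := by
    simp only [hψdef, hα, hβ]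
    field_simp
    rw [hWdef]; ring
  have hψ'z : deriv ψ z = d' := by
    rw [hψ' z hzρ]
    simp only [hα, hβ]
    field_simp
    rw [hWdef]; ring
  refine ⟨fun w => ψ w * w ^ (-(m : ℤ)), ?_, ?_, ?_, ?_⟩
  · exact (hψ 0 h0).meromorphicAt.mul ((MeromorphicAt.id 0).zpow _)
  · simp only [hψz, zpow_neg, zpow_natCast, hc']
    field_simp
  · rw [deriv_mul_zpow_neg hz0 (hψ z hzρ), hψz, hψ'z, hd', zpow_neg, zpow_natCast]
    field_simp
    ring
  · intro w hw hw0
    have hwρ : w ∈ Metric.ball (0 : ℂ) ρ := Metric.ball_subset_ball (min_le_left _ _) hw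
    refine ⟨(hψ w hwρ).mul (analyticAt_id.zpow hw0), ?_⟩
    refine deriv_deriv_mul_zpow_neg hw0 (hψ w hwρ) m ?_
    rw [hψ'' w hwρ, hψ' w hwρ]
    simp only [hψdef]
    linear_combination α * hode₁ w hwρ + β * hode₂ w hwρ

/-! ### The pole condition and its inheritance through the Riccati equation. -/

/-- Near `z`, `f (z + w) = r / w + h w` with an integer residue `r` and with `h` analytic and odd
up to order `2 |r|`. -/
def HasOddSimplePoleAt (f : ℂ → ℂ) (z : ℂ) : Prop :=
  ∃ (r : ℤ) (h : ℂ → ℂ), AnalyticAt ℂ h 0 ∧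
    ((2 * r.natAbs : ℕ) : ℕ∞) ≤ analyticOrderAt (fun w => h w + h (-w)) 0 ∧
    ∀ᶠ w in 𝓝[≠] (0 : ℂ), f (z + w) = r / w + h w

/-- Factoring `φ = w^j χ` with `χ 0 ≠ 0` gives residue `-j`; this is why residues are integers. -/
theorem exists_neg_logDeriv_eq {φ : ℂ → ℂ} (hφ : MeromorphicAt φ 0)
    (hne : meromorphicOrderAt φ 0 ≠ ⊤) :
    ∃ (s : ℤ) (k : ℂ → ℂ), AnalyticAt ℂ k 0 ∧
      ∀ᶠ w in 𝓝[≠] (0 : ℂ), -deriv φ w / φ w = s / w + k w := by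
  obtain ⟨χ, hχ, hχ0, heq⟩ := (meromorphicOrderAt_ne_top_iff hφ).1 hne
  set j := (meromorphicOrderAt φ 0).untop₀ with hj
  refine ⟨-j, fun w => -deriv χ w / χ w, hχ.deriv.neg.div hχ hχ0, ?_⟩
  have hne : ∀ᶠ w in 𝓝[≠] (0 : ℂ), χ w ≠ 0 :=
    (hχ.continuousAt.eventually_ne hχ0).filter_mono nhdsWithin_le_nhds
  filter_upwards [heq, eventually_eventually_nhdsWithin.2 heq, hne, self_mem_nhdsWithin,
    hχ.eventually_analyticAt.filter_mono nhdsWithin_le_nhds] with w h1 h2 h3 h4 h5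
  have h4 : w ≠ 0 := h4
  have h6 : φ =ᶠ[𝓝 w] fun w => w ^ j * χ w := by
    rw [← nhdsWithin_eq_nhds.2 (isOpen_compl_singleton.mem_nhds h4)]
    simpa [EventuallyEq] using h2
  have h7 := (hasDerivAt_zpow j w (Or.inl h4)).mul h5.differentiableAt.hasDerivAt
  have h8 : deriv φ w = _ := h6.deriv_eq.trans h7.deriv
  rw [h8, h6.self_of_nhds, zpow_sub_one₀ h4]
  have := zpow_ne_zero j h4
  push_cast
  field_simp
  ring

/-- A solution `g = -φ' / φ` of the Riccati equation `g' = g ^ 2 - (m (m + 1) / w ^ 2 + U w)`, with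
`U` even up to order `2 m`, is odd up to order `2 |s|`, where `s` is its residue. -/
theorem hasOddSimplePoleAt_zero_of_riccati {m : ℕ} {U φ g : ℂ → ℂ} (hU : AnalyticAt ℂ U 0)
    (heven : ((2 * m : ℕ) : ℕ∞) ≤ analyticOrderAt (fun w => U w - U (-w)) 0)
    (hφ : MeromorphicAt φ 0) (hne : meromorphicOrderAt φ 0 ≠ ⊤)
    (hg : ∀ᶠ w in 𝓝[≠] (0 : ℂ), g w = -deriv φ w / φ w)
    (hR : ∀ᶠ w in 𝓝[≠] (0 : ℂ), deriv g w = g w ^ 2 - (m * (m + 1) / w ^ 2 + U w)) :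
    HasOddSimplePoleAt g 0 := by
  obtain ⟨s, k, hk, hsk⟩ := exists_neg_logDeriv_eq hφ hne
  have hgs : ∀ᶠ w in 𝓝[≠] (0 : ℂ), g w = s / w + k w := by
    filter_upwards [hg, hsk] with w h1 h2 using h1.trans h2
  -- The Riccati equation multiplied by `w²`; its value at `0` is the indicial equation, hence `s =
  -- m` or `s = -(m + 1)`.
  have hR' : ∀ᶠ w in 𝓝[≠] (0 : ℂ), (s ^ 2 + s - m * (m + 1) : ℂ) =
      w * (w * (deriv k w - k w ^ 2 + U w) - 2 * s * k w) := by
    filter_upwards [hgs, eventually_eventually_nhdsWithin.2 hgs, hR, self_mem_nhdsWithin,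
      hk.eventually_analyticAt.filter_mono nhdsWithin_le_nhds] with w h1 h2 h3 h4 h5
    have h4 : w ≠ 0 := h4
    have h6 : g =ᶠ[𝓝 w] fun w => s / w + k w := by
      rwa [nhdsWithin_eq_nhds.2 (isOpen_compl_singleton.mem_nhds h4)] at h2
    have h7 := ((hasDerivAt_const w (s : ℂ)).div (hasDerivAt_id w) h4).add
      h5.differentiableAt.hasDerivAt
    have h8 : deriv g w = _ := h6.deriv_eq.trans h7.deriv
    rw [h8, h1] at h3
    simp only [id] at h3
    field_simp at h3
    linear_combination -h3
  have hs : (s ^ 2 + s - m * (m + 1) : ℂ) = 0 := by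
    have hc : AnalyticAt ℂ (fun w => w * (w * (deriv k w - k w ^ 2 + U w) - 2 * s * k w)) 0 :=
      analyticAt_id.mul ((analyticAt_id.mul ((hk.deriv.sub (hk.pow 2)).add hU)).sub
        (analyticAt_const.mul hk))
    have := (eventuallyEq_nhds_of_nhdsNE analyticAt_const hc hR').self_of_nhds
    simpa using this
  rw [hs] at hR'
  have hsZ : (s - m) * (s + m + 1) = 0 := by
    have : ((s ^ 2 + s - m * (m + 1) : ℤ) : ℂ) = 0 := by push_cast; exact hs
    have : (s ^ 2 + s - m * (m + 1) : ℤ) = 0 := by exact_mod_cast this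
    linear_combination this
  set e : ℂ → ℂ := fun w => k w + k (-w) with hedef
  have he : AnalyticAt ℂ e 0 := hk.add hk.comp_neg_zero
  obtain ⟨u, hu, hue⟩ := (natCast_le_analyticOrderAt (hU.sub hU.comp_neg_zero)).1 heven
  simp only [sub_zero, smul_eq_mul] at hue
  set d : ℂ → ℂ := fun w => k w - k (-w) with hddef
  have hd : AnalyticAt ℂ d 0 := hk.sub hk.comp_neg_zero
  -- Adding the equations at `w` and `-w` gives a linear equation for the even part `e`, forced only
  -- by the odd part of `U`.
  have hode : ∀ᶠ w in 𝓝[≠] (0 : ℂ),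
      w * deriv e w - 2 * s * e w - w * d w * e w = -(w ^ (2 * m + 1) * u w) := by
    filter_upwards [hR', tendsto_neg_zero_nhdsNE.eventually hR', self_mem_nhdsWithin,
      hue.filter_mono nhdsWithin_le_nhds,
      (deriv_add_comp_neg hk).filter_mono nhdsWithin_le_nhds] with w h1 h2 h3 h4 h5
    have h3 : w ≠ 0 := h3
    have h1' : w * (deriv k w - k w ^ 2 + U w) - 2 * s * k w = 0 :=
      (mul_eq_zero.1 h1.symm).resolve_left h3
    have h2' : -w * (deriv k (-w) - k (-w) ^ 2 + U (-w)) - 2 * s * k (-w) = 0 :=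
      (mul_eq_zero.1 h2.symm).resolve_left (neg_ne_zero.2 h3)
    have h4' : U w - U (-w) = w ^ (2 * m) * u w := h4
    simp only [hedef, hddef]
    rw [h5, pow_succ]
    linear_combination h1' + h2' - w * h4'
  refine ⟨s, k, hk, ?_, by simpa using hgs⟩
  change _ ≤ analyticOrderAt e 0
  rcases eq_or_ne (analyticOrderAt e 0) ⊤ with htop | htop
  · rw [htop]; exact le_top
  obtain ⟨n, hn⟩ := ENat.ne_top_iff_exists.1 htop
  have hneven : Even n := even_of_analyticOrderAt_add_comp_neg hk hn.symm
  rw [← hn]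
  -- Below the order of the forcing, the leading term of `e` must be killed by `n - 2s`.
  have hn' : (n : ℤ) = 2 * s ∨ 2 * m + 1 ≤ n := by
    by_contra! hcon
    obtain ⟨hn2s, hnlt⟩ := hcon
    obtain ⟨q, hq, hq0, hqe⟩ := he.analyticOrderAt_eq_natCast.1 hn.symm
    simp only [sub_zero, smul_eq_mul] at hqe
    obtain ⟨l, hl⟩ : ∃ l, 2 * m + 1 = n + (l + 1) := ⟨2 * m - n, by omega⟩
    have hkey : ∀ᶠ w in 𝓝[≠] (0 : ℂ), ((n : ℂ) - 2 * s) * q w =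
        w * (d w * q w - deriv q w - w ^ l * u w) := by
      filter_upwards [hode, hqe.filter_mono nhdsWithin_le_nhds,
        hqe.eventually_nhds.filter_mono nhdsWithin_le_nhds, self_mem_nhdsWithin,
        hq.eventually_analyticAt.filter_mono nhdsWithin_le_nhds] with w h1 h2 h3 h4 h5
      have h4 : w ≠ 0 := h4
      have h6 : deriv e w = _ := (EventuallyEq.deriv_eq (f := fun w => w ^ n * q w) h3).trans
        ((hasDerivAt_pow n w).mul h5.differentiableAt.hasDerivAt).deriv
      rw [h6, h2, hl, pow_add] at h1
      have h7 : w * ((n : ℂ) * w ^ (n - 1)) = n * w ^ n := by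
        rcases n with _ | n
        · simp
        · simp only [Nat.add_sub_cancel, pow_succ]; ring
      have hwn : w ^ n ≠ 0 := pow_ne_zero _ h4
      apply mul_left_cancel₀ hwn
      rw [pow_succ] at h1
      linear_combination h1 - q w * h7
    have h1 : AnalyticAt ℂ (fun w => ((n : ℂ) - 2 * s) * q w) 0 := analyticAt_const.mul hq
    have h2 : AnalyticAt ℂ (fun w => w * (d w * q w - deriv q w - w ^ l * u w)) 0 :=
      analyticAt_id.mul (((hd.mul hq).sub hq.deriv).sub ((analyticAt_id.pow l).mul hu))
    have h3 := (eventuallyEq_nhds_of_nhdsNE h1 h2 hkey).self_of_nhds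
    simp only [zero_mul, mul_eq_zero, hq0, or_false] at h3
    apply hn2s
    have : (((n : ℤ) - 2 * s : ℤ) : ℂ) = 0 := by push_cast; exact h3
    have : (n : ℤ) - 2 * s = 0 := by exact_mod_cast this
    linarith
  -- For `s = -(m + 1)` the bound needed is `2m + 2`: `n = 2s` is impossible by sign, and evenness
  -- improves `2m + 1` by one.
  rw [Nat.even_iff] at hneven
  have : 2 * s.natAbs ≤ n := by
    rcases mul_eq_zero.1 hsZ with h | h <;> omega
  exact_mod_cast this

/-! ### Local Riccati solutions at an arbitrary centre, and their uniqueness. -/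

theorem tendsto_const_add_nhdsNE (z w : ℂ) :
    Tendsto (fun x => z + x) (𝓝[≠] w) (𝓝[≠] (z + w)) :=
  tendsto_nhdsWithin_iff.2 ⟨(continuous_const.add continuous_id).continuousAt.mono_left
    nhdsWithin_le_nhds, eventually_nhdsWithin_of_forall fun _ hw => by simpa using hw⟩

theorem eventually_nhdsNE_add_iff {p : ℂ → Prop} (z w : ℂ) :
    (∀ᶠ x in 𝓝[≠] (z + w), p x) ↔ ∀ᶠ x in 𝓝[≠] w, p (z + x) := by
  refine ⟨fun h => (tendsto_const_add_nhdsNE z w).eventually h, fun h => ?_⟩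
  have := (tendsto_const_add_nhdsNE (-z) (z + w)).eventually (p := fun x => p (z + x))
    (by simpa using h)
  simpa using this

theorem eventually_nhdsNE_iff_add {p : ℂ → Prop} (z : ℂ) :
    (∀ᶠ x in 𝓝[≠] z, p x) ↔ ∀ᶠ x in 𝓝[≠] (0 : ℂ), p (z + x) := by
  rw [← eventually_nhdsNE_add_iff, add_zero]

theorem AnalyticAt.comp_const_add {f : ℂ → ℂ} {z w : ℂ} (hf : AnalyticAt ℂ f (z + w)) :
    AnalyticAt ℂ (fun x => f (z + x)) w :=
  AnalyticAt.comp (f := fun x => z + x) hf (analyticAt_const.add analyticAt_id)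

theorem hasOddSimplePoleAt_comp_add_iff {f : ℂ → ℂ} {z w : ℂ} :
    HasOddSimplePoleAt (fun x => f (z + x)) w ↔ HasOddSimplePoleAt f (z + w) := by
  simp only [HasOddSimplePoleAt, add_assoc]

theorem HasOddSimplePoleAt.congr {f g : ℂ → ℂ} {z : ℂ} (hf : HasOddSimplePoleAt f z)
    (h : f =ᶠ[𝓝[≠] z] g) : HasOddSimplePoleAt g z := by
  obtain ⟨r, k, hk, hodd, hev⟩ := hf
  refine ⟨r, k, hk, hodd, ?_⟩
  filter_upwards [hev, (eventually_nhdsNE_iff_add z).1 h] with w h1 h2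
  rw [← h2, h1]

theorem AnalyticAt.hasOddSimplePoleAt {f : ℂ → ℂ} {z : ℂ} (hf : AnalyticAt ℂ f z) :
    HasOddSimplePoleAt f z :=
  ⟨0, fun w => f (z + w), AnalyticAt.comp_const_add (by simpa using hf), by simp,
    Eventually.of_forall fun w => by simp⟩

/-- Where `f` is regular the potential is analytic, so `m = 0` and the evenness condition is void.
-/
theorem hasOddSimplePoleAt_of_riccati {f φ g : ℂ → ℂ} {μ z : ℂ} (hf : AnalyticAt ℂ f z)
    (hφ : AnalyticAt ℂ φ z) (hne : ∀ᶠ w in 𝓝[≠] z, φ w ≠ 0)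
    (hg : ∀ w, g w = -deriv φ w / φ w)
    (hR : ∀ᶠ w in 𝓝[≠] z, deriv g w = g w ^ 2 - deriv f w - f w ^ 2 + μ) :
    HasOddSimplePoleAt g z := by
  have hf0 : AnalyticAt ℂ f (z + 0) := by simpa using hf
  have hφ0 : AnalyticAt ℂ φ (z + 0) := by simpa using hφ
  rw [← add_zero z, ← hasOddSimplePoleAt_comp_add_iff]
  refine hasOddSimplePoleAt_zero_of_riccati (m := 0)
    (U := fun w => deriv f (z + w) + f (z + w) ^ 2 - μ) (φ := fun w => φ (z + w))
    ((hf0.deriv.comp_const_add.add (hf0.comp_const_add.pow 2)).sub analyticAt_const) (by simp)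
    hφ0.comp_const_add.meromorphicAt ?_ (Eventually.of_forall fun w => ?_) ?_
  · exact (meromorphicOrderAt_ne_top_iff_eventually_ne_zero hφ0.comp_const_add.meromorphicAt).2
      ((eventually_nhdsNE_iff_add z).1 hne)
  · rw [deriv_comp_const_add, hg]
  · filter_upwards [(eventually_nhdsNE_iff_add z).1 hR] with w hw
    rw [deriv_comp_const_add, hw]
    push_cast
    ring

theorem exists_riccati_solution_zero {f : ℂ → ℂ} (hf : HasOddSimplePoleAt f 0) (μ : ℂ) :
    ∃ ρ > 0, ∀ z ∈ Metric.ball (0 : ℂ) ρ, z ≠ 0 → ∀ c : ℂ, ∃ g : ℂ → ℂ,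
      AnalyticAt ℂ g z ∧ g z = c ∧ ∀ x ∈ Metric.ball (0 : ℂ) ρ, HasOddSimplePoleAt g x ∧
        ∀ᶠ w in 𝓝[≠] x, deriv g w = g w ^ 2 - deriv f w - f w ^ 2 + μ := by
  obtain ⟨r, h, hh, hodd, hev⟩ := hf
  simp only [zero_add] at hev
  obtain ⟨m, U, hm, hU, heven, hUw⟩ := exists_even_potential hh hodd μ
  obtain ⟨ρ₁, hρ₁, H⟩ := exists_schrodinger_solution hU heven
  obtain ⟨ρ₂, hρ₂, hball⟩ := Metric.mem_nhdsWithin_iff.1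
    (hev.and (hh.eventually_analyticAt.filter_mono nhdsWithin_le_nhds))
  have hpot : ∀ w ∈ Metric.ball (0 : ℂ) ρ₂, w ≠ 0 → AnalyticAt ℂ f w ∧
      deriv f w + f w ^ 2 - μ = m * (m + 1) / w ^ 2 + U w := by
    intro w hw hw0
    have hfw : f =ᶠ[𝓝 w] fun x => r / x + h x := by
      filter_upwards [Metric.isOpen_ball.mem_nhds hw, isOpen_ne.mem_nhds hw0] with x hx hx0
      exact (hball ⟨hx, hx0⟩).1
    have hhw : AnalyticAt ℂ h w := (hball ⟨hw, hw0⟩).2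
    refine ⟨((analyticAt_const.div analyticAt_id hw0).add hhw).congr hfw.symm, ?_⟩
    have hd : deriv f w = _ := hfw.deriv_eq.trans (((hasDerivAt_const w (r : ℂ)).div
      (hasDerivAt_id w) hw0).add hhw.differentiableAt.hasDerivAt).deriv
    rw [hd, hfw.self_of_nhds, hUw w hw0, hm]
    simp only [id]
    field_simp
    ring
  refine ⟨min ρ₁ ρ₂, lt_min hρ₁ hρ₂, fun z hz hz0 c => ?_⟩
  have hsub₁ := Metric.ball_subset_ball (x := (0 : ℂ)) (min_le_left ρ₁ ρ₂)
  have hsub₂ := Metric.ball_subset_ball (x := (0 : ℂ)) (min_le_right ρ₁ ρ₂)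
  -- The data `φ z = 1`, `φ' z = -c` give `-φ'/φ = c` at `z`.
  obtain ⟨φ, hφ0, hφz, hφ'z, hφ⟩ := H z (hsub₁ hz) hz0 1 (-c)
  have hφan : ∀ w ∈ Metric.ball (0 : ℂ) (min ρ₁ ρ₂), w ≠ 0 → AnalyticAt ℂ φ w :=
    fun w hw hw0 => (hφ w (hsub₁ hw) hw0).1
  have hmero : MeromorphicOn φ (Metric.ball 0 (min ρ₁ ρ₂)) := by
    intro w hw
    rcases eq_or_ne w 0 with rfl | hw0
    · exact hφ0
    · exact (hφan w hw hw0).meromorphicAt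
  have hzne : meromorphicOrderAt φ z ≠ ⊤ := by
    rw [meromorphicOrderAt_ne_top_iff_eventually_ne_zero (hmero z hz)]
    exact ((hφan z hz hz0).continuousAt.eventually_ne
      (by rw [hφz]; exact one_ne_zero)).filter_mono nhdsWithin_le_nhds
  have hord : ∀ x ∈ Metric.ball (0 : ℂ) (min ρ₁ ρ₂), meromorphicOrderAt φ x ≠ ⊤ :=
    fun x hx => hmero.meromorphicOrderAt_ne_top_of_isPreconnected
      (convex_ball (0 : ℂ) _).isPreconnected hz hx hzne
  have hne : ∀ x ∈ Metric.ball (0 : ℂ) (min ρ₁ ρ₂), ∀ᶠ w in 𝓝[≠] x, φ w ≠ 0 := fun x hx =>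
    (meromorphicOrderAt_ne_top_iff_eventually_ne_zero (hmero x hx)).1 (hord x hx)
  set g : ℂ → ℂ := fun w => -deriv φ w / φ w with hg
  have hgd : ∀ w ∈ Metric.ball (0 : ℂ) (min ρ₁ ρ₂), w ≠ 0 → φ w ≠ 0 →
      deriv g w = g w ^ 2 - deriv f w - f w ^ 2 + μ := by
    intro w hw hw0 hφw
    have h1 := hφan w hw hw0
    have h2 := (h1.deriv.differentiableAt.hasDerivAt.neg.div
      h1.differentiableAt.hasDerivAt hφw).deriv
    have h3 : deriv g w = _ := h2
    rw [h3, (hφ w (hsub₁ hw) hw0).2, ← (hpot w (hsub₂ hw) hw0).2]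
    simp only [hg, Pi.neg_apply]
    field_simp
    ring
  have hev0 : ∀ x : ℂ, ∀ᶠ w in 𝓝[≠] x, w ≠ 0 := by
    intro x
    rcases eq_or_ne x 0 with rfl | hx
    · exact self_mem_nhdsWithin
    · exact (isOpen_ne.eventually_mem hx).filter_mono nhdsWithin_le_nhds
  have hR : ∀ x ∈ Metric.ball (0 : ℂ) (min ρ₁ ρ₂),
      ∀ᶠ w in 𝓝[≠] x, deriv g w = g w ^ 2 - deriv f w - f w ^ 2 + μ := by
    intro x hx
    filter_upwards [hne x hx, hev0 x, nhdsWithin_le_nhds (Metric.isOpen_ball.mem_nhds hx)]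
      with w h1 h2 h3 using hgd w h3 h2 h1
  refine ⟨g, (hφan z hz hz0).deriv.neg.div (hφan z hz hz0) (by rw [hφz]; exact one_ne_zero), ?_,
    fun x hx => ⟨?_, hR x hx⟩⟩
  · simp [hg, hφz, hφ'z]
  · rcases eq_or_ne x 0 with rfl | hx0
    · refine hasOddSimplePoleAt_zero_of_riccati hU heven hφ0 (hord 0 hx)
        (Eventually.of_forall fun w => rfl) ?_
      filter_upwards [hR 0 hx, hev0 0, nhdsWithin_le_nhds (Metric.isOpen_ball.mem_nhds hx)]
        with w h1 h2 h3
      rw [h1, ← (hpot w (hsub₂ h3) h2).2]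
      ring
    · exact hasOddSimplePoleAt_of_riccati (hpot x (hsub₂ hx) hx0).1 (hφan x hx hx0) (hne x hx)
        (fun w => rfl) (hR x hx)

theorem HasOddSimplePoleAt.exists_riccati_solution {f : ℂ → ℂ} {z₀ : ℂ}
    (hf : HasOddSimplePoleAt f z₀) (μ : ℂ) :
    ∃ ρ > 0, ∀ z ∈ Metric.ball z₀ ρ, z ≠ z₀ → ∀ c : ℂ, ∃ g : ℂ → ℂ,
      AnalyticAt ℂ g z ∧ g z = c ∧ ∀ x ∈ Metric.ball z₀ ρ, HasOddSimplePoleAt g x ∧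
        ∀ᶠ w in 𝓝[≠] x, deriv g w = g w ^ 2 - deriv f w - f w ^ 2 + μ := by
  have hf0 : HasOddSimplePoleAt (fun w => f (z₀ + w)) 0 :=
    hasOddSimplePoleAt_comp_add_iff.2 (by simpa using hf)
  obtain ⟨ρ, hρ, H⟩ := exists_riccati_solution_zero hf0 μ
  have hmem : ∀ x ∈ Metric.ball z₀ ρ, -z₀ + x ∈ Metric.ball (0 : ℂ) ρ := by
    intro x hx
    rw [mem_ball_zero_iff]
    rw [mem_ball_iff_norm] at hx
    rwa [neg_add_eq_sub]
  refine ⟨ρ, hρ, fun z hz hzne c => ?_⟩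
  obtain ⟨g, hgz, hgc, hg⟩ := H (-z₀ + z) (hmem z hz)
    (by rw [neg_add_eq_sub]; exact sub_ne_zero.2 hzne) c
  refine ⟨fun w => g (-z₀ + w), hgz.comp_const_add, hgc, fun x hx => ?_⟩
  obtain ⟨h1, h2⟩ := hg _ (hmem x hx)
  refine ⟨hasOddSimplePoleAt_comp_add_iff.2 h1, ?_⟩
  have := (eventually_nhdsNE_add_iff (-z₀) x).1 h2
  filter_upwards [this] with w hw
  rw [deriv_comp_const_add, hw, deriv_comp_const_add]
  simp

/-- The difference satisfies the linear equation `y' = (g₁ + g₂) y`. -/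
theorem eventuallyEq_of_riccati {g₁ g₂ v : ℂ → ℂ} {z : ℂ} (h₁ : AnalyticAt ℂ g₁ z)
    (h₂ : AnalyticAt ℂ g₂ z) (hz : g₁ z = g₂ z)
    (hR₁ : ∀ᶠ w in 𝓝[≠] z, deriv g₁ w = g₁ w ^ 2 - v w)
    (hR₂ : ∀ᶠ w in 𝓝[≠] z, deriv g₂ w = g₂ w ^ 2 - v w) : g₁ =ᶠ[𝓝 z] g₂ := by
  have hd : deriv (g₁ - g₂) =ᶠ[𝓝 z] fun w => (g₁ w + g₂ w) * (g₁ - g₂) w := by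
    refine eventuallyEq_nhds_of_nhdsNE (h₁.sub h₂).deriv ((h₁.add h₂).mul (h₁.sub h₂)) ?_
    filter_upwards [hR₁, hR₂, h₁.eventually_analyticAt.filter_mono nhdsWithin_le_nhds,
      h₂.eventually_analyticAt.filter_mono nhdsWithin_le_nhds] with w e₁ e₂ a₁ a₂
    rw [deriv_sub a₁.differentiableAt a₂.differentiableAt, e₁, e₂, Pi.sub_apply]
    ring
  filter_upwards [(h₁.sub h₂).eventually_eq_zero_of_deriv_eq_mul (h₁.add h₂)
    (by simp [hz]) hd] with w hw
  exact sub_eq_zero.1 hw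

/-! ### Identity theorem for meromorphic germs, up to values at isolated points. -/

theorem HasOddSimplePoleAt.meromorphicAt {f : ℂ → ℂ} {z : ℂ} (hf : HasOddSimplePoleAt f z) :
    MeromorphicAt f z := by
  obtain ⟨r, h, hh, -, hev⟩ := hf
  have h0 : AnalyticAt ℂ (fun w => h (w - z)) z :=
    AnalyticAt.comp_of_eq (f := fun w => w - z) hh (analyticAt_id.sub analyticAt_const)
      (sub_self z)
  have h1 : MeromorphicAt (fun w => (r : ℂ) / (w - z) + h (w - z)) z :=
    ((MeromorphicAt.const (r : ℂ) z).div
      ((MeromorphicAt.id z).sub (MeromorphicAt.const z z))).add h0.meromorphicAt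
  refine h1.congr ?_
  refine (eventually_nhdsNE_iff_add z).2 (hev.mono fun w hw => ?_)
  simp only [hw, add_sub_cancel_left]

theorem MeromorphicOn.eventuallyEq_of_isPreconnected {F G : ℂ → ℂ} {U : Set ℂ}
    (hF : MeromorphicOn F U) (hG : MeromorphicOn G U) (hU : IsPreconnected U) {x y : ℂ}
    (hx : x ∈ U) (hy : y ∈ U) (h : F =ᶠ[𝓝[≠] x] G) : F =ᶠ[𝓝[≠] y] G := by
  have hx' : meromorphicOrderAt (F - G) x = ⊤ :=
    meromorphicOrderAt_eq_top_iff.2 (h.mono fun w hw => by simp [hw])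
  have hy' : meromorphicOrderAt (F - G) y = ⊤ := by
    by_contra hne
    exact (hF.sub hG).meromorphicOrderAt_ne_top_of_isPreconnected hU hy hx hne hx'
  exact (meromorphicOrderAt_eq_top_iff.1 hy').mono fun w hw => sub_eq_zero.1 hw

theorem deriv_eventuallyEq_nhdsNE {F G : ℂ → ℂ} {z : ℂ} (h : F =ᶠ[𝓝[≠] z] G) :
    deriv F =ᶠ[𝓝[≠] z] deriv G := by
  filter_upwards [eventually_eventually_nhdsWithin.2 h, self_mem_nhdsWithin] with w h1 h2
  rw [nhdsWithin_eq_nhds.2 (isOpen_compl_singleton.mem_nhds h2)] at h1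
  exact EventuallyEq.deriv_eq h1

theorem isPreconnected_Ioo_reProdIm_Ioo (a b c d : ℝ) :
    IsPreconnected (Set.Ioo a b ×ℂ Set.Ioo c d) :=
  (((convex_Ioo a b).linear_preimage Complex.reLm).inter
    ((convex_Ioo c d).linear_preimage Complex.imLm)).isPreconnected

theorem isOpen_Ioo_reProdIm_Ioo (a b c d : ℝ) : IsOpen (Set.Ioo a b ×ℂ Set.Ioo c d) :=
  isOpen_Ioo.reProdIm isOpen_Ioo

/-! ### Continuation to the right along a thin strip. -/

/-- `F` solves the delay differential equation on the rectangle `(α, T) × (ξ - ε, ξ + ε)`, where it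
is meromorphic with odd simple poles, and it coincides with `f` to the left of `γ`. -/
structure IsContinuation (a : ℝ) (μ : ℂ) (f : ℂ → ℂ) (α γ ξ T ε : ℝ) (F : ℂ → ℂ) : Prop where
  odd : ∀ z ∈ Set.Ioo α T ×ℂ Set.Ioo (ξ - ε) (ξ + ε), HasOddSimplePoleAt F z
  dde : ∀ z ∈ Set.Ioo α T ×ℂ Set.Ioo (ξ - ε) (ξ + ε),
    (a : ℂ) + z ∈ Set.Ioo α T ×ℂ Set.Ioo (ξ - ε) (ξ + ε) →
    ∀ᶠ w in 𝓝[≠] z, deriv F (a + w) = F (a + w) ^ 2 - deriv F w - F w ^ 2 + μ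
  agree : ∀ z ∈ Set.Ioo α T ×ℂ Set.Ioo (ξ - ε) (ξ + ε), z.re < γ → F =ᶠ[𝓝[≠] z] f

section

variable {a : ℝ} {μ : ℂ} {f : ℂ → ℂ} {α γ ξ T ε : ℝ} {F : ℂ → ℂ}

theorem IsContinuation.meromorphicOn (h : IsContinuation a μ f α γ ξ T ε F) :
    MeromorphicOn F (Set.Ioo α T ×ℂ Set.Ioo (ξ - ε) (ξ + ε)) :=
  fun z hz => (h.odd z hz).meromorphicAt

theorem IsContinuation.mono (h : IsContinuation a μ f α γ ξ T ε F) {T' ε' : ℝ} (hT : T' ≤ T)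
    (hε : ε' ≤ ε) : IsContinuation a μ f α γ ξ T' ε' F := by
  have hsub : Set.Ioo α T' ×ℂ Set.Ioo (ξ - ε') (ξ + ε') ⊆
      Set.Ioo α T ×ℂ Set.Ioo (ξ - ε) (ξ + ε) := by
    intro z hz
    rw [Complex.mem_reProdIm] at hz ⊢
    simp only [Set.mem_Ioo] at hz ⊢
    refine ⟨⟨?_, ?_⟩, ?_, ?_⟩ <;> linarith [hz.1.1, hz.1.2, hz.2.1, hz.2.2]
  exact ⟨fun z hz => h.odd z (hsub hz), fun z hz hz' => h.dde z (hsub hz) (hsub hz'),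
    fun z hz => h.agree z (hsub hz)⟩

/-- The common rectangle is connected and, as `α < γ`, contains points left of `γ`, where both
functions agree with `f`. -/
theorem IsContinuation.eventuallyEq {F' : ℂ → ℂ} (h : IsContinuation a μ f α γ ξ T ε F)
    {T' ε' : ℝ} (h' : IsContinuation a μ f α γ ξ T' ε' F') (hγ : α < γ) {z : ℂ}
    (hz : z ∈ Set.Ioo α T ×ℂ Set.Ioo (ξ - ε) (ξ + ε))
    (hz' : z ∈ Set.Ioo α T' ×ℂ Set.Ioo (ξ - ε') (ξ + ε')) : F =ᶠ[𝓝[≠] z] F' := by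
  have hm := h.mono (min_le_left T T') (min_le_left ε ε')
  have hm' := h'.mono (min_le_right T T') (min_le_right ε ε')
  rw [Complex.mem_reProdIm] at hz hz'
  simp only [Set.mem_Ioo] at hz hz'
  have hzm : z ∈ Set.Ioo α (min T T') ×ℂ Set.Ioo (ξ - min ε ε') (ξ + min ε ε') := by
    rw [Complex.mem_reProdIm]
    refine ⟨⟨hz.1.1, lt_min hz.1.2 hz'.1.2⟩, ?_, ?_⟩
    · rcases min_choice ε ε' with e | e <;> rw [e] <;> linarith [hz.2.1, hz'.2.1]
    · rcases min_choice ε ε' with e | e <;> rw [e] <;> linarith [hz.2.2, hz'.2.2]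
  obtain ⟨x, hx1, hx2⟩ := exists_between (lt_min hγ (hz.1.1.trans (lt_min hz.1.2 hz'.1.2)))
  have hp : (⟨x, z.im⟩ : ℂ) ∈ Set.Ioo α (min T T') ×ℂ Set.Ioo (ξ - min ε ε') (ξ + min ε ε') := by
    rw [Complex.mem_reProdIm] at hzm ⊢
    exact ⟨⟨hx1, hx2.trans_le (min_le_right _ _)⟩, hzm.2⟩
  have hxγ : x < γ := hx2.trans_le (min_le_left _ _)
  exact hm.meromorphicOn.eventuallyEq_of_isPreconnected hm'.meromorphicOn
    (isPreconnected_Ioo_reProdIm_Ioo _ _ _ _) hp hzm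
    ((hm.agree _ hp hxγ).trans (hm'.agree _ hp hxγ).symm)

theorem HasOddSimplePoleAt.comp_sub {g : ℂ → ℂ} {z b : ℂ} (h : HasOddSimplePoleAt g (z - b)) :
    HasOddSimplePoleAt (fun w => g (w - b)) z := by
  have : (fun w => g (w - b)) = fun w => g (-b + w) := by
    funext w; rw [neg_add_eq_sub]
  rw [this]
  refine hasOddSimplePoleAt_comp_add_iff.2 ?_
  rwa [neg_add_eq_sub]

/-- The heights for `t < T` may shrink to zero as `t → T`. The remedy is to solve the Riccati
equation on a ball about `z₀ = T - a + iξ`, whose radius depends only on `F₁`, match it there with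
the shift of a continuation `F₂` reaching `T - ε`, and translate it by `a` across `Re = T`. -/
theorem exists_isContinuation_gt (ha : 0 < a) {β : ℝ} (hαγ : α < γ) (hγβ : γ < β)
    (hαβ : α + a < β) (hβT : β ≤ T)
    (h : ∀ t < T, ∃ ε > 0, ∃ F, IsContinuation a μ f α γ ξ t ε F) :
    ∃ T' > T, ∃ ε > 0, ∃ F, IsContinuation a μ f α γ ξ T' ε F := by
  obtain ⟨T₁, hT₁, hT₁T⟩ := exists_between (show T - a < T by linarith)
  obtain ⟨ε₁, hε₁, F₁, hF₁⟩ := h T₁ hT₁T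
  set z₀ : ℂ := ⟨T - a, ξ⟩ with hz₀
  have hz₀mem : z₀ ∈ Set.Ioo α T₁ ×ℂ Set.Ioo (ξ - ε₁) (ξ + ε₁) := by
    rw [Complex.mem_reProdIm]
    refine ⟨⟨?_, ?_⟩, ?_, ?_⟩ <;> simp only [hz₀] <;> linarith
  obtain ⟨ρ, hρ, hloc⟩ := (hF₁.odd z₀ hz₀mem).exists_riccati_solution μ
  -- `ρ / 4` fits the box of half-sides `2ε` and `η ≤ ε` in the ball, `a / 2` puts the unshifted
  -- point of each equation left of `T - ε`, and `β - γ` gives `γ < T - ε`.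
  obtain ⟨ε, hε, hεs⟩ := exists_between (show 0 < min (min (ρ / 4) (ε₁ / 2))
      (min (min (a / 2) ((T - a - α) / 2)) (min ((T₁ - (T - a)) / 2) (β - γ))) by
    refine lt_min (lt_min ?_ ?_) (lt_min (lt_min ?_ ?_) (lt_min ?_ ?_)) <;> linarith)
  simp only [lt_min_iff] at hεs
  obtain ⟨⟨hερ, hεε₁⟩, ⟨hεa, hεα⟩, hεT₁, hεγ⟩ := hεs
  obtain ⟨ε₂, hε₂, F₂, hF₂⟩ := h (T - ε) (by linarith)
  set η := min ε ε₂ with hη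
  have hη0 : 0 < η := lt_min hε hε₂
  have hηε : η ≤ ε := min_le_left _ _
  have hηε₂ : η ≤ ε₂ := min_le_right _ _
  have hball : ∀ z : ℂ, T - a - 2 * ε < z.re → z.re < T - a + 2 * ε → ξ - η < z.im →
      z.im < ξ + η → z ∈ Metric.ball z₀ ρ := by
    intro z h1 h2 h3 h4
    rw [mem_ball_iff_norm]
    refine (Complex.norm_le_abs_re_add_abs_im _).trans_lt ?_
    have h5 : |(z - z₀).re| < 2 * ε := by
      rw [abs_lt]; simp only [Complex.sub_re, hz₀]; constructor <;> linarith
    have h6 : |(z - z₀).im| < ε := by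
      rw [abs_lt]; simp only [Complex.sub_im, hz₀]; constructor <;> linarith
    linarith
  set Q := Set.Ioo (T - a - 2 * ε) (T - a - ε) ×ℂ Set.Ioo (ξ - η) (ξ + η) with hQ
  have hQF₂ : ∀ z ∈ Q, z ∈ Set.Ioo α (T - ε) ×ℂ Set.Ioo (ξ - ε₂) (ξ + ε₂) ∧
      (a : ℂ) + z ∈ Set.Ioo α (T - ε) ×ℂ Set.Ioo (ξ - ε₂) (ξ + ε₂) := by
    intro z hz
    rw [hQ, Complex.mem_reProdIm] at hz
    simp only [Set.mem_Ioo] at hz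
    simp only [Complex.mem_reProdIm, Set.mem_Ioo, Complex.add_re, Complex.add_im,
      Complex.ofReal_re, Complex.ofReal_im]
    obtain ⟨⟨_, _⟩, _, _⟩ := hz
    refine ⟨⟨⟨?_, ?_⟩, ?_, ?_⟩, ⟨?_, ?_⟩, ?_, ?_⟩ <;> linarith
  have hF₂₁ : ∀ z : ℂ, α < z.re → z.re < T - a + 2 * ε → z.re < T - ε → ξ - η < z.im →
      z.im < ξ + η → F₂ =ᶠ[𝓝[≠] z] F₁ := by
    intro z h1 h2 h3 h4 h5
    refine hF₂.eventuallyEq hF₁ hαγ ?_ ?_ <;> rw [Complex.mem_reProdIm] <;>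
      refine ⟨⟨?_, ?_⟩, ?_, ?_⟩ <;> linarith
  have hshift : ∀ z ∈ Q, MeromorphicAt (fun w => F₂ (a + w)) z := fun z hz =>
    (hasOddSimplePoleAt_comp_add_iff.2 (hF₂.odd _ (hQF₂ z hz).2)).meromorphicAt
  set p : ℂ := ⟨T - a - 3 / 2 * ε, ξ⟩ with hp
  have hpQ : p ∈ Q := by
    rw [hQ, Complex.mem_reProdIm]
    refine ⟨⟨?_, ?_⟩, ?_, ?_⟩ <;> simp only [hp] <;> linarith
  -- A nearby regular point of the shifted `F₂`, so that its value can serve as initial condition.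
  obtain ⟨z₁, hz₁, hz₁Q⟩ := ((hshift p hpQ).eventually_analyticAt.and
    (nhdsWithin_le_nhds ((isOpen_Ioo_reProdIm_Ioo _ _ _ _).mem_nhds hpQ))).exists
  change z₁ ∈ Q at hz₁Q
  have hz₁' := hz₁Q
  rw [hQ, Complex.mem_reProdIm] at hz₁'
  simp only [Set.mem_Ioo] at hz₁'
  obtain ⟨⟨hz1, hz2⟩, hz3, hz4⟩ := hz₁'
  have hz₁ne : z₁ ≠ z₀ := by
    intro e; rw [e] at hz2; simp only [hz₀] at hz2; linarith
  obtain ⟨g, hgan, hgval, hg⟩ := hloc z₁ (hball z₁ hz1 (by linarith) hz3 hz4) hz₁ne (F₂ (a + z₁))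
  have hgz₁ : g =ᶠ[𝓝 z₁] fun w => F₂ (a + w) := by
    refine eventuallyEq_of_riccati (v := fun w => deriv F₁ w + F₁ w ^ 2 - μ) hgan hz₁ hgval ?_ ?_
    · filter_upwards [(hg z₁ (hball z₁ hz1 (by linarith) hz3 hz4)).2] with w hw
      rw [hw]; ring
    · have he := hF₂₁ z₁ (by linarith) (by linarith) (by linarith) hz3 hz4
      filter_upwards [hF₂.dde z₁ (hQF₂ z₁ hz₁Q).1 (hQF₂ z₁ hz₁Q).2, he,
        deriv_eventuallyEq_nhdsNE he] with w h1 h2 h3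
      rw [deriv_comp_const_add, h1, h2, h3]; ring
  have hgQ : ∀ z ∈ Q, g =ᶠ[𝓝[≠] z] fun w => F₂ (a + w) := by
    intro z hz
    refine MeromorphicOn.eventuallyEq_of_isPreconnected (U := Q) (fun x hx => ?_) hshift
      (isPreconnected_Ioo_reProdIm_Ioo _ _ _ _) hz₁Q hz (hgz₁.filter_mono nhdsWithin_le_nhds)
    rw [hQ, Complex.mem_reProdIm] at hx
    simp only [Set.mem_Ioo] at hx
    exact (hg x (hball x hx.1.1 (by linarith [hx.1.2]) hx.2.1 hx.2.2)).1.meromorphicAt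
  -- The cut lies mid-way in the overlap `(T - 2ε, T - ε)`, where both branches have the same germs.
  set G : ℂ → ℂ := fun z => if z.re < T - 3 / 2 * ε then F₂ z else g (z - a) with hG
  have hoverlap : ∀ z : ℂ, T - 2 * ε < z.re → z.re < T - ε → ξ - η < z.im → z.im < ξ + η →
      F₂ =ᶠ[𝓝[≠] z] fun w => g (w - a) := by
    intro z h1 h2 h3 h4
    have hzQ : z - a ∈ Q := by
      rw [hQ, Complex.mem_reProdIm]
      refine ⟨⟨?_, ?_⟩, ?_, ?_⟩ <;> simp <;> linarith
    have h5 := (eventually_nhdsNE_add_iff (-(a : ℂ)) z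
      (p := fun w => g w = F₂ (a + w))).1 (by rw [neg_add_eq_sub]; exact hgQ _ hzQ)
    filter_upwards [h5] with w hw
    rw [neg_add_eq_sub] at hw
    rw [hw, add_sub_cancel]
  have hGL : ∀ z : ℂ, z.re < T - ε → ξ - η < z.im → z.im < ξ + η → G =ᶠ[𝓝[≠] z] F₂ := by
    intro z h1 h2 h3
    by_cases h4 : T - 2 * ε < z.re
    · filter_upwards [hoverlap z h4 h1 h2 h3] with w hw
      simp only [hG]; split_ifs
      · rfl
      · exact hw.symm
    · have : ∀ᶠ w : ℂ in 𝓝 z, w.re < T - 3 / 2 * ε :=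
        Complex.continuous_re.continuousAt.eventually_lt continuousAt_const (by linarith)
      filter_upwards [nhdsWithin_le_nhds this] with w hw
      simp only [hG]; rw [if_pos hw]
  have hGR : ∀ z : ℂ, T - 2 * ε < z.re → ξ - η < z.im → z.im < ξ + η →
      G =ᶠ[𝓝[≠] z] fun w => g (w - a) := by
    intro z h1 h2 h3
    by_cases h4 : z.re < T - ε
    · filter_upwards [hoverlap z h1 h4 h2 h3] with w hw
      simp only [hG]; split_ifs
      · exact hw
      · rfl
    · have : ∀ᶠ w : ℂ in 𝓝 z, T - 3 / 2 * ε < w.re :=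
        continuousAt_const.eventually_lt Complex.continuous_re.continuousAt (by linarith)
      filter_upwards [nhdsWithin_le_nhds this] with w hw
      simp only [hG]; rw [if_neg (not_lt.2 hw.le)]
  refine ⟨T + ε, by linarith, η, hη0, G, ?_, ?_, ?_⟩
  · intro z hz
    rw [Complex.mem_reProdIm] at hz
    simp only [Set.mem_Ioo] at hz
    obtain ⟨⟨h1, h2⟩, h3, h4⟩ := hz
    by_cases h5 : z.re < T - ε
    · refine (hF₂.odd z ?_).congr (hGL z h5 h3 h4).symm
      rw [Complex.mem_reProdIm]
      refine ⟨⟨?_, ?_⟩, ?_, ?_⟩ <;> linarith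
    · refine HasOddSimplePoleAt.congr ?_ (hGR z (by linarith) h3 h4).symm
      refine (hg (z - a) (hball _ ?_ ?_ ?_ ?_)).1.comp_sub <;> simp <;> linarith
  · intro z hz hz'
    rw [Complex.mem_reProdIm] at hz hz'
    simp only [Set.mem_Ioo, Complex.add_re, Complex.add_im, Complex.ofReal_re,
      Complex.ofReal_im] at hz hz'
    obtain ⟨⟨h1, h2⟩, h3, h4⟩ := hz
    have h2' := hz'.1.2
    have eL := hGL z (by linarith) h3 h4
    by_cases h5 : a + z.re < T - ε
    · have eR := (eventually_nhdsNE_add_iff (a : ℂ) z).1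
        (hGL (a + z) (by simpa using h5) (by simpa using h3) (by simpa using h4))
      have eR' := (eventually_nhdsNE_add_iff (a : ℂ) z).1 (deriv_eventuallyEq_nhdsNE
        (hGL (a + z) (by simpa using h5) (by simpa using h3) (by simpa using h4)))
      have hd := hF₂.dde z (by rw [Complex.mem_reProdIm]; refine ⟨⟨?_, ?_⟩, ?_, ?_⟩ <;> linarith)
        (by
          rw [Complex.mem_reProdIm]
          refine ⟨⟨?_, ?_⟩, ?_, ?_⟩ <;> simp <;> linarith)
      filter_upwards [eL, deriv_eventuallyEq_nhdsNE eL, eR, eR', hd] with w e1 e2 e3 e4 e5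
      rw [e1, e2, e3, e4, e5]
    · have e := hGR (a + z) (by simp; linarith) (by simpa using h3) (by simpa using h4)
      have eR := (eventually_nhdsNE_add_iff (a : ℂ) z).1 e
      have eR' := (eventually_nhdsNE_add_iff (a : ℂ) z).1 (deriv_eventuallyEq_nhdsNE e)
      have e1 := eL.trans (hF₂₁ z h1 (by linarith) (by linarith) h3 h4)
      filter_upwards [e1, deriv_eventuallyEq_nhdsNE e1, eR, eR',
        (hg z (hball z (by linarith) (by linarith) h3 h4)).2] with w e1 e2 e3 e4 e5
      rw [e1, e2, e3, e4, deriv_comp_sub_const, add_sub_cancel_left, e5]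
  · intro z hz hzγ
    rw [Complex.mem_reProdIm] at hz
    simp only [Set.mem_Ioo] at hz
    obtain ⟨⟨h1, h2⟩, h3, h4⟩ := hz
    refine (hGL z (by linarith) h3 h4).trans (hF₂.agree z ?_ hzγ)
    rw [Complex.mem_reProdIm]
    refine ⟨⟨?_, ?_⟩, ?_, ?_⟩ <;> linarith

/-- The reachable abscissae form a down-set; were it bounded, the extension step would pass its
supremum. -/
theorem exists_isContinuation (ha : 0 < a) {β : ℝ} (hαγ : α < γ) (hγβ : γ < β)
    (hαβ : α + a < β) (hβ : ∃ ε > 0, ∃ F, IsContinuation a μ f α γ ξ β ε F) (T : ℝ) :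
    ∃ ε > 0, ∃ F, IsContinuation a μ f α γ ξ T ε F := by
  set P : Set ℝ := {T | ∃ ε > 0, ∃ F, IsContinuation a μ f α γ ξ T ε F} with hP
  have hmono : ∀ t ∈ P, ∀ s ≤ t, s ∈ P := by
    rintro t ⟨ε, hε, F, hF⟩ s hs
    exact ⟨ε, hε, F, hF.mono hs le_rfl⟩
  by_contra hT
  have hbdd : BddAbove P := ⟨T, fun t ht => by
    by_contra hlt
    exact hT (hmono t ht T (not_le.1 hlt).le)⟩
  have hlt : ∀ t < sSup P, t ∈ P := by
    intro t ht
    obtain ⟨s, hs, hts⟩ := exists_lt_of_lt_csSup ⟨β, hβ⟩ ht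
    exact hmono s hs t hts.le
  obtain ⟨T', hT', h'⟩ := exists_isContinuation_gt ha hαγ hγβ hαβ (le_csSup hbdd hβ) hlt
  exact absurd (le_csSup hbdd h') (not_le.2 hT')

end

/-! ### Extension to both sides of a strip. -/

theorem HasOddSimplePoleAt.neg_one_le_meromorphicOrderAt {f : ℂ → ℂ} {z : ℂ}
    (hf : HasOddSimplePoleAt f z) : -1 ≤ meromorphicOrderAt f z := by
  have hm := hf.meromorphicAt
  obtain ⟨r, h, hh, -, hev⟩ := hf
  have hid : MeromorphicAt (fun w => w - z) z := (MeromorphicAt.id z).sub (MeromorphicAt.const z z)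
  have hmul := meromorphicOrderAt_mul hid hm
  rw [meromorphicOrderAt_id_sub_const] at hmul
  have han : AnalyticAt ℂ (fun w => r + (w - z) * h (w - z)) z :=
    analyticAt_const.add ((analyticAt_id.sub analyticAt_const).mul
      (AnalyticAt.comp_of_eq (f := fun w => w - z) hh (analyticAt_id.sub analyticAt_const)
        (sub_self z)))
  have hcongr : ((fun w => w - z) * f) =ᶠ[𝓝[≠] z] fun w => r + (w - z) * h (w - z) := by
    refine (eventually_nhdsNE_iff_add z).2 ?_
    filter_upwards [hev, self_mem_nhdsWithin] with w hw hw0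
    have hw0 : w ≠ 0 := hw0
    simp only [Pi.mul_apply, hw, add_sub_cancel_left]
    field_simp
  have hnonneg := han.meromorphicOrderAt_nonneg
  rw [← meromorphicOrderAt_congr hcongr, hmul] at hnonneg
  cases h : meromorphicOrderAt f z with
  | top => exact le_top
  | coe n =>
    rw [h] at hnonneg
    have : (0 : ℤ) ≤ 1 + n := by exact_mod_cast hnonneg
    have : (-1 : ℤ) ≤ n := by linarith
    exact WithTop.coe_le_coe.2 this

theorem exists_meromorphic_right {a : ℝ} {μ : ℂ} {f : ℂ → ℂ} {α β γ ξ ε₀ : ℝ} (ha : 0 < a)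
    (hαγ : α < γ) (hγβ : γ < β) (hαβ : α + a < β) (hε₀ : 0 < ε₀)
    (hf : ∀ z ∈ Set.Ioo α β ×ℂ Set.Ioo (ξ - ε₀) (ξ + ε₀), AnalyticAt ℂ f z)
    (hsol : ∀ z ∈ Set.Ioo α β ×ℂ Set.Ioo (ξ - ε₀) (ξ + ε₀),
      (a : ℂ) + z ∈ Set.Ioo α β ×ℂ Set.Ioo (ξ - ε₀) (ξ + ε₀) →
      deriv f (a + z) = f (a + z) ^ 2 - deriv f z - f z ^ 2 + μ) (T : ℝ) :
    ∃ ε > 0, ∃ F : ℂ → ℂ, ∀ z ∈ Set.Ioo α T ×ℂ Set.Ioo (ξ - ε) (ξ + ε),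
      MeromorphicAt F z ∧ -1 ≤ meromorphicOrderAt F z ∧ (z.re < γ → F =ᶠ[𝓝[≠] z] f) := by
  have hbase : IsContinuation a μ f α γ ξ β ε₀ f := by
    refine ⟨fun z hz => (hf z hz).hasOddSimplePoleAt, fun z hz hz' => ?_, fun z _ _ => .rfl⟩
    have hopen := isOpen_Ioo_reProdIm_Ioo α β (ξ - ε₀) (ξ + ε₀)
    have h2 : ∀ᶠ w in 𝓝 z, (a : ℂ) + w ∈ Set.Ioo α β ×ℂ Set.Ioo (ξ - ε₀) (ξ + ε₀) :=
      (continuous_const.add continuous_id).continuousAt.eventually (hopen.mem_nhds hz')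
    filter_upwards [nhdsWithin_le_nhds (hopen.mem_nhds hz), nhdsWithin_le_nhds h2] with w h3 h4
    exact hsol w h3 h4
  obtain ⟨ε, hε, F, hF⟩ := exists_isContinuation ha hαγ hγβ hαβ ⟨ε₀, hε₀, f, hbase⟩ T
  exact ⟨ε, hε, F, fun z hz => ⟨(hF.odd z hz).meromorphicAt,
    (hF.odd z hz).neg_one_le_meromorphicOrderAt, hF.agree z hz⟩⟩

theorem eventuallyEq_comp_neg {F f : ℂ → ℂ} {z : ℂ} (h : F =ᶠ[𝓝[≠] (-z)] fun w => f (-w)) :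
    (fun w => F (-w)) =ᶠ[𝓝[≠] z] f := by
  have ht : Tendsto (fun w : ℂ => -w) (𝓝[≠] z) (𝓝[≠] (-z)) :=
    tendsto_nhdsWithin_iff.2 ⟨continuous_neg.continuousAt.mono_left nhdsWithin_le_nhds,
      eventually_nhdsWithin_of_forall fun w hw => by simpa using hw⟩
  filter_upwards [ht.eventually h] with w hw
  rw [hw, neg_neg]

/-- The function `f (-x)` solves the same equation with `-μ`, so the right-hand extension applies to
it. -/
theorem exists_meromorphic_left {a : ℝ} {μ : ℂ} {f : ℂ → ℂ} {α β γ ξ ε₀ : ℝ} (ha : 0 < a)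
    (hαγ : α < γ) (hγβ : γ < β) (hαβ : α + a < β) (hε₀ : 0 < ε₀)
    (hf : ∀ z ∈ Set.Ioo α β ×ℂ Set.Ioo (ξ - ε₀) (ξ + ε₀), AnalyticAt ℂ f z)
    (hsol : ∀ z ∈ Set.Ioo α β ×ℂ Set.Ioo (ξ - ε₀) (ξ + ε₀),
      (a : ℂ) + z ∈ Set.Ioo α β ×ℂ Set.Ioo (ξ - ε₀) (ξ + ε₀) →
      deriv f (a + z) = f (a + z) ^ 2 - deriv f z - f z ^ 2 + μ) (T : ℝ) :
    ∃ ε > 0, ∃ F : ℂ → ℂ, ∀ z ∈ Set.Ioo (-T) β ×ℂ Set.Ioo (ξ - ε) (ξ + ε),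
      MeromorphicAt F z ∧ -1 ≤ meromorphicOrderAt F z ∧ (γ < z.re → F =ᶠ[𝓝[≠] z] f) := by
  have hmem : ∀ z : ℂ, z ∈ Set.Ioo (-β) (-α) ×ℂ Set.Ioo (-ξ - ε₀) (-ξ + ε₀) →
      -z ∈ Set.Ioo α β ×ℂ Set.Ioo (ξ - ε₀) (ξ + ε₀) := by
    intro z hz
    simp only [Complex.mem_reProdIm, Set.mem_Ioo, Complex.neg_re, Complex.neg_im] at hz ⊢
    obtain ⟨⟨_, _⟩, _, _⟩ := hz
    refine ⟨⟨?_, ?_⟩, ?_, ?_⟩ <;> linarith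
  obtain ⟨ε, hε, F, hF⟩ := exists_meromorphic_right (a := a) (μ := -μ) (f := fun z => f (-z))
    (α := -β) (β := -α) (γ := -γ) (ξ := -ξ) ha (by linarith) (by linarith) (by linarith) hε₀
    (fun z hz => AnalyticAt.comp (f := fun w : ℂ => -w) (hf _ (hmem z hz)) analyticAt_id.neg)
    (fun z hz hz' => by
      have h := hsol (-(a + z)) (hmem _ hz') (by simpa using hmem _ hz)
      simp only [neg_add, add_neg_cancel_left] at h
      rw [deriv_comp_neg, deriv_comp_neg, neg_add, h]
      ring) T
  refine ⟨ε, hε, fun z => F (-z), fun z hz => ?_⟩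
  obtain ⟨h1, h2, h3⟩ := hF (-z) (by
    simp only [Complex.mem_reProdIm, Set.mem_Ioo, Complex.neg_re, Complex.neg_im] at hz ⊢
    obtain ⟨⟨_, _⟩, _, _⟩ := hz
    refine ⟨⟨?_, ?_⟩, ?_, ?_⟩ <;> linarith)
  have hneg : AnalyticAt ℂ (fun w : ℂ => -w) z := analyticAt_id.neg
  have hneg' : deriv (fun w : ℂ => -w) z ≠ 0 := by simp
  refine ⟨(meromorphicAt_comp_iff_of_deriv_ne_zero hneg hneg').2 h1,
    ((meromorphicOrderAt_comp_of_deriv_ne_zero hneg hneg').ge.trans' h2), fun hγ => ?_⟩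
  exact eventuallyEq_comp_neg (h3 (by rw [Complex.neg_re]; linarith))

theorem exists_meromorphic_strip {a : ℝ} {μ : ℂ} {f : ℂ → ℂ} {α β ξ ε₀ : ℝ} (ha : 0 < a)
    (hαβ : α + a < β) (hε₀ : 0 < ε₀)
    (hf : ∀ z ∈ Set.Ioo α β ×ℂ Set.Ioo (ξ - ε₀) (ξ + ε₀), AnalyticAt ℂ f z)
    (hsol : ∀ z ∈ Set.Ioo α β ×ℂ Set.Ioo (ξ - ε₀) (ξ + ε₀),
      (a : ℂ) + z ∈ Set.Ioo α β ×ℂ Set.Ioo (ξ - ε₀) (ξ + ε₀) →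
      deriv f (a + z) = f (a + z) ^ 2 - deriv f z - f z ^ 2 + μ) (M : ℝ) :
    ∃ ε > 0, ∃ F : ℂ → ℂ, ∀ z ∈ Set.Ioo (-M) M ×ℂ Set.Ioo (ξ - ε) (ξ + ε),
      MeromorphicAt F z ∧ -1 ≤ meromorphicOrderAt F z ∧
      (z.re = (α + β) / 2 → F =ᶠ[𝓝[≠] z] f) := by
  -- The two bounds `γ` cut `(α, β)` in thirds: both extensions equal `f` on the middle third, which
  -- contains the gluing line.
  obtain ⟨ε₁, hε₁, F₁, hF₁⟩ := exists_meromorphic_right (γ := (α + 2 * β) / 3) ha (by linarith)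
    (by linarith) hαβ hε₀ hf hsol M
  obtain ⟨ε₂, hε₂, F₂, hF₂⟩ := exists_meromorphic_left (γ := (2 * α + β) / 3) ha (by linarith)
    (by linarith) hαβ hε₀ hf hsol M
  set G : ℂ → ℂ := fun z => if z.re < (α + β) / 2 then F₂ z else F₁ z with hG
  have hlt : α < β := by linarith
  refine ⟨min ε₁ ε₂, lt_min hε₁ hε₂, G, fun z hz => ?_⟩
  simp only [Complex.mem_reProdIm, Set.mem_Ioo] at hz
  obtain ⟨⟨h1, h2⟩, h3, h4⟩ := hz
  have hm₁ := min_le_left ε₁ ε₂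
  have hm₂ := min_le_right ε₁ ε₂
  have hmem₁ : α < z.re → z ∈ Set.Ioo α M ×ℂ Set.Ioo (ξ - ε₁) (ξ + ε₁) := fun h => by
    rw [Complex.mem_reProdIm]; refine ⟨⟨?_, ?_⟩, ?_, ?_⟩ <;> linarith
  have hmem₂ : z.re < β → z ∈ Set.Ioo (-M) β ×ℂ Set.Ioo (ξ - ε₂) (ξ + ε₂) := fun h => by
    rw [Complex.mem_reProdIm]; refine ⟨⟨?_, ?_⟩, ?_, ?_⟩ <;> linarith
  rcases lt_trichotomy z.re ((α + β) / 2) with hre | hre | hre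
  · have hGz : F₂ =ᶠ[𝓝[≠] z] G := by
      have : ∀ᶠ w : ℂ in 𝓝 z, w.re < (α + β) / 2 :=
        Complex.continuous_re.continuousAt.eventually_lt continuousAt_const hre
      filter_upwards [nhdsWithin_le_nhds this] with w hw
      simp only [hG]; rw [if_pos hw]
    obtain ⟨e1, e2, -⟩ := hF₂ z (hmem₂ (by linarith))
    exact ⟨e1.congr hGz, e2.trans_eq (meromorphicOrderAt_congr hGz), fun h => absurd h hre.ne⟩
  · obtain ⟨e1, e2, e3⟩ := hF₁ z (hmem₁ (by linarith))
    obtain ⟨-, -, e4⟩ := hF₂ z (hmem₂ (by linarith))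
    have hGf : G =ᶠ[𝓝[≠] z] f := by
      filter_upwards [e3 (by linarith), e4 (by linarith)] with w h5 h6
      simp only [hG]; split_ifs
      · exact h6
      · exact h5
    have hGz : F₁ =ᶠ[𝓝[≠] z] G := (e3 (by linarith)).trans hGf.symm
    exact ⟨e1.congr hGz, e2.trans_eq (meromorphicOrderAt_congr hGz), fun _ => hGf⟩
  · have hGz : F₁ =ᶠ[𝓝[≠] z] G := by
      have : ∀ᶠ w : ℂ in 𝓝 z, (α + β) / 2 < w.re :=
        continuousAt_const.eventually_lt Complex.continuous_re.continuousAt hre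
      filter_upwards [nhdsWithin_le_nhds this] with w hw
      simp only [hG]; rw [if_neg (not_lt.2 hw.le)]
    obtain ⟨e1, e2, -⟩ := hF₁ z (hmem₁ (by linarith))
    exact ⟨e1.congr hGz, e2.trans_eq (meromorphicOrderAt_congr hGz), fun h => absurd h hre.ne'⟩

/-! ### Rectangles around every point and their patching. -/

theorem EReal.exists_real_btwn_add_lt {a : ℝ} {x y : EReal} (h : (a : EReal) < y - x) :
    ∃ α β : ℝ, x < α ∧ (β : EReal) < y ∧ α + a < β := by
  induction x with
  | top => simp at h
  | bot =>
    induction y with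
    | bot => simp at h
    | top => exact ⟨0, a + 1, by simp, EReal.coe_lt_top _, by linarith⟩
    | coe y => exact ⟨y - a - 2, y - 1 / 2, EReal.bot_lt_coe _, by exact_mod_cast (by linarith), by linarith⟩
  | coe x =>
    induction y with
    | bot => simp at h
    | top =>
      exact ⟨x + 1, x + a + 2, by exact_mod_cast (by linarith), EReal.coe_lt_top _, by linarith⟩
    | coe y =>
      have h' : a < y - x := by exact_mod_cast h
      exact ⟨x + (y - x - a) / 4, y - (y - x - a) / 4, by exact_mod_cast (by linarith),
        by exact_mod_cast (by linarith), by linarith⟩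

/-- A meromorphic germ-wise extension of `f` from `R` to the rectangle `(-M, M) × (c, d)`, every
row of which meets `R`. -/
structure IsRectangleExtension (f : ℂ → ℂ) (R : Set ℂ) (M c d : ℝ) (F : ℂ → ℂ) : Prop where
  meromorphicOn : MeromorphicOn F (Set.Ioo (-M) M ×ℂ Set.Ioo c d)
  order : ∀ z ∈ Set.Ioo (-M) M ×ℂ Set.Ioo c d, -1 ≤ meromorphicOrderAt F z
  agree : ∀ z ∈ Set.Ioo (-M) M ×ℂ Set.Ioo c d, z ∈ R → F =ᶠ[𝓝[≠] z] f
  meets : ∀ y ∈ Set.Ioo c d, ∃ x ∈ Set.Ioo (-M) M, (⟨x, y⟩ : ℂ) ∈ R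

/-- Rectangles centred on the imaginary axis make the narrower one's point of `R` in the row of `z`
lie in both; equality spreads from it over their intersection. -/
theorem IsRectangleExtension.eventuallyEq_of_le {f : ℂ → ℂ} {R : Set ℂ} {M M' c c' d d' : ℝ}
    {F F' : ℂ → ℂ} (h : IsRectangleExtension f R M c d F)
    (h' : IsRectangleExtension f R M' c' d' F') (hM : M ≤ M') {z : ℂ}
    (hz : z ∈ Set.Ioo (-M) M ×ℂ Set.Ioo c d) (hz' : z ∈ Set.Ioo (-M') M' ×ℂ Set.Ioo c' d') :
    F =ᶠ[𝓝[≠] z] F' := by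
  rw [Complex.mem_reProdIm] at hz hz'
  simp only [Set.mem_Ioo] at hz hz'
  obtain ⟨x, hx, hxR⟩ := h.meets z.im hz.2
  have hsub : Set.Ioo (-M) M ×ℂ Set.Ioo (max c c') (min d d') ⊆ Set.Ioo (-M) M ×ℂ Set.Ioo c d := by
    intro w hw
    rw [Complex.mem_reProdIm] at hw ⊢
    exact ⟨hw.1, (le_max_left _ _).trans_lt hw.2.1, hw.2.2.trans_le (min_le_left _ _)⟩
  have hsub' : Set.Ioo (-M) M ×ℂ Set.Ioo (max c c') (min d d') ⊆
      Set.Ioo (-M') M' ×ℂ Set.Ioo c' d' := by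
    intro w hw
    rw [Complex.mem_reProdIm] at hw ⊢
    exact ⟨⟨by linarith [hw.1.1], hw.1.2.trans_le hM⟩, (le_max_right _ _).trans_lt hw.2.1,
      hw.2.2.trans_le (min_le_right _ _)⟩
  have hzm : z ∈ Set.Ioo (-M) M ×ℂ Set.Ioo (max c c') (min d d') := by
    rw [Complex.mem_reProdIm]
    exact ⟨hz.1, max_lt hz.2.1 hz'.2.1, lt_min hz.2.2 hz'.2.2⟩
  have hp : (⟨x, z.im⟩ : ℂ) ∈ Set.Ioo (-M) M ×ℂ Set.Ioo (max c c') (min d d') := by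
    rw [Complex.mem_reProdIm] at hzm ⊢
    exact ⟨hx, hzm.2⟩
  exact (h.meromorphicOn.mono_set hsub).eventuallyEq_of_isPreconnected
    (h'.meromorphicOn.mono_set hsub') (isPreconnected_Ioo_reProdIm_Ioo _ _ _ _) hp hzm
    ((h.agree _ (hsub hp) hxR).trans (h'.agree _ (hsub' hp) hxR).symm)

theorem IsRectangleExtension.eventuallyEq {f : ℂ → ℂ} {R : Set ℂ} {M M' c c' d d' : ℝ}
    {F F' : ℂ → ℂ} (h : IsRectangleExtension f R M c d F)
    (h' : IsRectangleExtension f R M' c' d' F') {z : ℂ}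
    (hz : z ∈ Set.Ioo (-M) M ×ℂ Set.Ioo c d) (hz' : z ∈ Set.Ioo (-M') M' ×ℂ Set.Ioo c' d') :
    F =ᶠ[𝓝[≠] z] F' := by
  rcases le_total M M' with hM | hM
  · exact h.eventuallyEq_of_le h' hM hz hz'
  · exact (h'.eventuallyEq_of_le h hM hz' hz).symm

/-- Local meromorphic extensions near every point patch together to a global one. -/
theorem exists_meromorphic_extension_of_rectangles {f : ℂ → ℂ} {R : Set ℂ}
    (hf : AnalyticOnNhd ℂ f R)
    (h : ∀ z : ℂ, ∃ (M c d : ℝ) (F : ℂ → ℂ), z ∈ Set.Ioo (-M) M ×ℂ Set.Ioo c d ∧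
      IsRectangleExtension f R M c d F) :
    ∃ F : ℂ → ℂ, MeromorphicOn F Set.univ ∧ Set.EqOn F f R ∧
      ∀ z : ℂ, ¬ AnalyticAt ℂ F z → meromorphicOrderAt F z = -1 := by
  choose M c d G hmem hG using h
  -- The normal-form value depends only on the punctured germ, so the choice of rectangle is
  -- immaterial and regular points receive the right value.
  set F : ℂ → ℂ := fun z => toMeromorphicNFAt (G z) z z with hF
  have hFG : ∀ z, F =ᶠ[𝓝 z] toMeromorphicNFAt (G z) z := by
    intro z
    have hm := (hG z).meromorphicOn z (hmem z)
    have hne : F =ᶠ[𝓝[≠] z] toMeromorphicNFAt (G z) z := by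
      filter_upwards [hm.eventually_analyticAt, hm.eq_nhdsNE_toMeromorphicNFAt,
        nhdsWithin_le_nhds ((isOpen_Ioo_reProdIm_Ioo _ _ _ _).mem_nhds (hmem z))] with w h1 h2 h3
      have h4 := (hG w).eventuallyEq (hG z) (hmem w) h3
      have h5 := (toMeromorphicNFAt_eventuallyEq_nhds_congr h4).self_of_nhds
      rw [toMeromorphicNFAt_eq_self.2 h1.meromorphicNFAt] at h5
      exact h5.trans h2
    rw [EventuallyEq, ← nhdsNE_sup_pure, eventually_sup]
    exact ⟨hne, rfl⟩
  refine ⟨F, fun z _ => ?_, fun z hz => ?_, fun z hz => ?_⟩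
  · exact ((meromorphicNFAt_congr (hFG z)).2 meromorphicNFAt_toMeromorphicNFAt).meromorphicAt
  · have h1 := (toMeromorphicNFAt_eventuallyEq_nhds_congr
      ((hG z).agree z (hmem z) hz)).self_of_nhds
    rwa [toMeromorphicNFAt_eq_self.2 (hf z hz).meromorphicNFAt] at h1
  · have hNF := (meromorphicNFAt_congr (hFG z)).2
      (meromorphicNFAt_toMeromorphicNFAt (f := G z) (x := z))
    have h1 : ¬ 0 ≤ meromorphicOrderAt F z := fun h0 =>
      hz (hNF.meromorphicOrderAt_nonneg_iff_analyticAt.1 h0)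
    have h2 : -1 ≤ meromorphicOrderAt F z := by
      rw [meromorphicOrderAt_congr ((hFG z).filter_mono nhdsWithin_le_nhds),
        ((hG z).meromorphicOn z (hmem z)).meromorphicOrderAt_toMeromorphicNFAt]
      exact (hG z).order z (hmem z)
    cases h3 : meromorphicOrderAt F z with
    | top => rw [h3] at h1; exact absurd le_top h1
    | coe n =>
      rw [h3] at h1 h2
      have h4 : ¬ (0 : ℤ) ≤ n := fun h => h1 (WithTop.coe_le_coe.2 h)
      have h5 : (-1 : ℤ) ≤ n := WithTop.coe_le_coe.1 h2
      have h6 : n = -1 := by omega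
      rw [h6]; rfl

/-- Rows of the region are intervals, so equality with `f` spreads from the midpoint along each row,
even if the region meets the rectangle in a disconnected set. -/
theorem isPreconnected_row_inter (η₁ η₂ : ℝ → EReal) (M y : ℝ) :
    IsPreconnected ((fun x : ℝ => (⟨x, y⟩ : ℂ)) ''
      {x | x ∈ Set.Ioo (-M) M ∧ (⟨x, y⟩ : ℂ) ∈ domainBetween η₁ η₂}) := by
  refine IsPreconnected.image ?_ _ ?_
  · refine Set.OrdConnected.isPreconnected ⟨fun x hx x' hx' t ht => ⟨?_, ?_, ?_⟩⟩
    · exact ⟨hx.1.1.trans_le ht.1, ht.2.trans_lt hx'.1.2⟩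
    · exact hx.2.1.trans_le (EReal.coe_le_coe_iff.2 ht.1)
    · exact (EReal.coe_le_coe_iff.2 ht.2).trans_lt hx'.2.2
  · have : (fun x : ℝ => (⟨x, y⟩ : ℂ)) = fun x : ℝ => (x : ℂ) + y * Complex.I := by
      funext x; apply Complex.ext <;> simp
    rw [this]
    fun_prop

theorem exists_isRectangleExtension {a : ℝ} (ha : 0 < a) {μ : ℂ} {η₁ η₂ : ℝ → EReal}
    (hopen : IsOpen (domainBetween η₁ η₂)) (hwide : IsWideOn a η₁ η₂ Set.univ) {f : ℂ → ℂ}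
    (hf : AnalyticOnNhd ℂ f (domainBetween η₁ η₂))
    (hsol : IsDDESolutionOn a μ f (domainBetween η₁ η₂)) (z : ℂ) :
    ∃ (M c d : ℝ) (F : ℂ → ℂ), z ∈ Set.Ioo (-M) M ×ℂ Set.Ioo c d ∧
      IsRectangleExtension f (domainBetween η₁ η₂) M c d F := by
  obtain ⟨α, β, hα, hβ, hαβ⟩ := EReal.exists_real_btwn_add_lt (hwide z.im (Set.mem_univ _))
  have hK : IsCompact ((fun x : ℝ => (x : ℂ) + z.im * Complex.I) '' Set.Icc α β) :=
    isCompact_Icc.image (by fun_prop)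
  have hKR : (fun x : ℝ => (x : ℂ) + z.im * Complex.I) '' Set.Icc α β ⊆ domainBetween η₁ η₂ := by
    rintro _ ⟨x, hx, rfl⟩
    refine ⟨?_, ?_⟩ <;> simp
    · exact hα.trans_le (EReal.coe_le_coe_iff.2 hx.1)
    · exact (EReal.coe_le_coe_iff.2 hx.2).trans_lt hβ
  -- Compactness of the segment at height `z.im` gives a rectangle inside the region still wider
  -- than `a`.
  obtain ⟨ε₀, hε₀, hthick⟩ := hK.exists_thickening_subset_open hopen hKR
  have hrect : ∀ w ∈ Set.Ioo α β ×ℂ Set.Ioo (z.im - ε₀) (z.im + ε₀), w ∈ domainBetween η₁ η₂ := by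
    intro w hw
    simp only [Complex.mem_reProdIm, Set.mem_Ioo] at hw
    refine hthick (Metric.mem_thickening_iff.2
      ⟨_, ⟨w.re, ⟨hw.1.1.le, hw.1.2.le⟩, rfl⟩, ?_⟩)
    rw [Complex.dist_of_re_eq (by simp), Real.dist_eq, abs_lt]
    simp only [Complex.add_im, Complex.ofReal_im, Complex.mul_im, Complex.ofReal_re, Complex.I_im,
      Complex.I_re, mul_one, mul_zero, zero_add, add_zero]
    constructor <;> linarith [hw.2.1, hw.2.2]
  set M : ℝ := |z.re| + |α| + |β| + 1 with hM
  have hMz : |z.re| < M := by linarith [abs_nonneg α, abs_nonneg β]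
  have hMm : |(α + β) / 2| < M := by
    have h1 := abs_add_le α β
    rw [abs_div, abs_two]
    linarith [abs_nonneg α, abs_nonneg β, abs_nonneg z.re]
  rw [abs_lt] at hMz hMm
  obtain ⟨ε₁, hε₁, F, hF⟩ := exists_meromorphic_strip (f := f) (μ := μ) ha hαβ hε₀
    (fun w hw => hf w (hrect w hw))
    (fun w hw hw' => by
      have hcomm : w + (a : ℂ) = a + w := add_comm _ _
      have h1 := hsol w (hrect w hw) (by rw [hcomm]; exact hrect _ hw')
      have h2 : HasDerivAt (fun y => f (y + (a : ℂ))) (deriv f (w + a)) w := by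
        have := (hf _ (hrect _ hw')).differentiableAt.hasDerivAt
        rw [← hcomm] at this
        exact this.comp_add_const w a
      have h3 := ((hf _ (hrect w hw)).differentiableAt.hasDerivAt.add h2).deriv
      have h4 : deriv (fun y => f y + f (y + (a : ℂ))) w = _ := h3
      rw [h4, hcomm] at h1
      linear_combination h1) M
  set ε := min ε₀ ε₁ with hε
  have hε0 : ε ≤ ε₀ := min_le_left _ _
  have hε1 : ε ≤ ε₁ := min_le_right _ _
  have hεpos : 0 < ε := lt_min hε₀ hε₁
  have hsub : ∀ w ∈ Set.Ioo (-M) M ×ℂ Set.Ioo (z.im - ε) (z.im + ε),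
      w ∈ Set.Ioo (-M) M ×ℂ Set.Ioo (z.im - ε₁) (z.im + ε₁) := by
    intro w hw
    rw [Complex.mem_reProdIm] at hw ⊢
    exact ⟨hw.1, by linarith [hw.2.1], by linarith [hw.2.2]⟩
  have hmid : ∀ y ∈ Set.Ioo (z.im - ε) (z.im + ε),
      (⟨(α + β) / 2, y⟩ : ℂ) ∈ domainBetween η₁ η₂ := by
    intro y hy
    refine hrect _ ?_
    rw [Complex.mem_reProdIm]
    refine ⟨⟨?_, ?_⟩, ?_, ?_⟩ <;> simp only <;> linarith [hy.1, hy.2]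
  have hmero : MeromorphicOn F (Set.Ioo (-M) M ×ℂ Set.Ioo (z.im - ε) (z.im + ε)) :=
    fun w hw => (hF w (hsub w hw)).1
  refine ⟨M, z.im - ε, z.im + ε, F, ?_, hmero, fun w hw => (hF w (hsub w hw)).2.1,
    fun w hw hwR => ?_, fun y hy => ⟨(α + β) / 2, ⟨hMm.1, hMm.2⟩, hmid y hy⟩⟩
  · rw [Complex.mem_reProdIm]
    exact ⟨⟨hMz.1, hMz.2⟩, by linarith, by linarith⟩
  · set L := (fun x : ℝ => (⟨x, w.im⟩ : ℂ)) ''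
      {x | x ∈ Set.Ioo (-M) M ∧ (⟨x, w.im⟩ : ℂ) ∈ domainBetween η₁ η₂} with hL
    rw [Complex.mem_reProdIm] at hw
    have hLF : MeromorphicOn F L := by
      rintro _ ⟨x, hx, rfl⟩
      exact hmero _ (Complex.mem_reProdIm.2 ⟨hx.1, hw.2⟩)
    have hLf : MeromorphicOn f L := by
      rintro _ ⟨x, hx, rfl⟩
      exact (hf _ hx.2).meromorphicAt
    have hp : (⟨(α + β) / 2, w.im⟩ : ℂ) ∈ L := ⟨_, ⟨⟨hMm.1, hMm.2⟩, hmid _ hw.2⟩, rfl⟩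
    have hwL : w ∈ L := ⟨w.re, ⟨hw.1, hwR⟩, rfl⟩
    refine hLF.eventuallyEq_of_isPreconnected hLf (isPreconnected_row_inter η₁ η₂ M w.im) hp hwL ?_
    exact (hF ⟨(α + β) / 2, w.im⟩ (hsub _ (Complex.mem_reProdIm.2 ⟨⟨hMm.1, hMm.2⟩, hw.2⟩))).2.2 rfl

theorem theorem1 (a : ℝ) (ha : 0 < a) (μ : ℂ) (η₁ η₂ : ℝ → EReal)
    (hopen : IsOpen (domainBetween η₁ η₂))
    (hwide : IsWideOn a η₁ η₂ Set.univ)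
    (f : ℂ → ℂ)
    (hf : AnalyticOnNhd ℂ f (domainBetween η₁ η₂))
    (hsol : IsDDESolutionOn a μ f (domainBetween η₁ η₂)) :
    ∃ F : ℂ → ℂ,
      MeromorphicOn F Set.univ ∧
      Set.EqOn F f (domainBetween η₁ η₂) ∧
      ∀ z : ℂ, ¬ AnalyticAt ℂ F z → meromorphicOrderAt F z = -1 :=
  exists_meromorphic_extension_of_rectangles hf
    (exists_isRectangleExtension ha hopen hwide hf hsol)
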